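/- \textbf{Setting.} Consider an episodic MDP with state space $\mathcal S$ (a measurable space), finite non-empty action set $\mathcal A$, horizon $H\ge 1$, transition kernels $P_h$, deterministic rewards $r_h\ge 0$ with $\sum_{h=1}^H r_h(s_h,a_h)\le 1$ for all sequences of states and actions, and fixed initial state $s_1$. For a deterministic policy $\pi$ let $V_h^\pi,Q_h^\pi$ be its value functions, $V^\star_h=\sup_\pi V^\pi_h$, $Q^\star_h=\sup_\pi Q^\pi_h$; $\pi$ is $\epsilon$-optimal if $V_1^\pi(s_1)\ge V_1^\star(s_1)-\epsilon$. Let $\mathcal F=\mathcal F_1\times\dots\times\mathcal F_H$ be a finite class of (measurable) functions $\mathcal F_h\subseteq(\mathcal S\times\mathcal A\to[0,1])$ with $|\mathcal F|\ge 2$, with the convention $f_{H+1}=0$, and for $f\in\mathcal F$ let $\pi_f$ be a (measurable) greedy policy, $\pi_{f,h}(s)\in\arg\max_a f_h(s,a)$. Put $(\mathcal T_h g)(s,a)=r_h(s,a)+\mathbb E_{s'\sim P_h(\cdot\mid s,a)}\max_{a'}g(s',a')$. \textbf{Dimension.} For a class $\mathcal G$ of real functions on $\mathcal X$, a probability measure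 $\nu$ is $\epsilon$-independent of $\mu_1,\dots,\mu_n$ if some $g\in\mathcal G$ has $\sqrt{\sum_i(\mathbb E_{\mu_i}g)^2}\le\epsilon$ and $|\mathbb E_\nu g|>\epsilon$. For a family $\Pi$ of probability measures, $\dim_{\rm DE}(\mathcal G,\Pi,\epsilon)$ is the length of the longest sequence in $\Pi$ such that for some $\epsilon'\ge\epsilon$ every element is $\epsilon'$-independent of its predecessors. Let $\mathcal G_h=\{s\mapsto (f_h-\mathcal T_hf_{h+1})(s,\pi_{f,h}(s)):f\in\mathcal F\}$, let $\mathcal D_{\mathcal F,h}$ be the set of laws of the state $s_h$ under the policies $\pi_f$, $f\in\mathcal F$, and $\dim_{\rm VBE}(\mathcal F,\mathcal D_{\mathcal F},\epsilon)=\max_h\dim_{\rm DE}(\mathcal G_h,\mathcal D_{\mathcal F,h},\epsilon)$. \textbf{Algorithm} (V-type OLIVE with parameters $\zeta_{\rm act},\zeta_{\rm elim},n_{\rm act},n_{\rm elim}$). Start with $\mathcal B^0=\mathcal F$. In phase $k=1,2,\dots$: choose $f^k\in\arg\max_{f\in\mathcal B^{k-1}}f_1(s_1,\pi_{f,1}(s_1))$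 and $\pi^k=\pi_{f^k}$. Run $\pi^k$ for $n_{\rm act}$ fresh episodes and let $\tilde{\mathcal E}_h$ be the average over them of $f^k_h(s_h,a_h)-r_h-\max_{a'}f^k_{h+1}(s_{h+1},a')$. If $\sum_h\tilde{\mathcal E}_h\le H\zeta_{\rm act}$, terminate and output $\pi^k$. Otherwise pick any $t$ with $\tilde{\mathcal E}_t>\zeta_{\rm act}$; collect $n_{\rm elim}$ fresh episodes following $\pi^k$ at steps $1,\dots,t-1$ and taking a uniformly random action at step $t$; for each $f$ let $\hat{\mathcal E}(f)$ be the average over them of $|\mathcal A|\,\mathbf 1[a_t=\pi_{f,t}(s_t)]\,(f_t(s_t,a_t)-r_t-\max_{a'}f_{t+1}(s_{t+1},a'))$, and set $\mathcal B^k=\{f\in\mathcal B^{k-1}:|\hat{\mathcal E}(f)|\le\zeta_{\rm elim}\}$. The maximizer may be chosen by any rule depending on $k$ and $\mathcal B^{k-1}$, and $t$ by any (measurable) rule depending on $k$, $\mathcal B^{k-1}$ and the $n_{\rm act}$ episodes just collected. \textbf{Theorem.} There are absolute constants $c,C_1,C_2>0$ such that the following holds for every such MDP and class. Assume realizability, $Q_h^\star\in\mathcal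 F_h$ for all $h$. Let $\epsilon,\delta\in(0,1]$, let $d\ge 1$ be an integer with $\dim_{\rm VBE}(\mathcal F,\mathcal D_{\mathcal F},\epsilon/H)\le d$ (for example $d$ equal to this dimension, if it is not $0$), and assume $Hd|\mathcal A|/(\delta\epsilon)\ge 2$ (automatic if $|\mathcal A|\ge2$). Put $\iota=c\log\big(Hd|\mathcal A|/(\delta\epsilon)\big)$ and $$\zeta_{\rm act}=\frac{2\epsilon}{H},\quad \zeta_{\rm elim}=\frac{\epsilon}{2H\sqrt d},\quad n_{\rm act}=\Big\lceil\frac{H^2\iota}{\epsilon^2}\Big\rceil,\quad n_{\rm elim}=\Big\lceil\frac{H^2d|\mathcal A|\log(|\mathcal F|)\,\iota}{\epsilon^2}\Big\rceil .$$ Then with probability at least $1-\delta$, V-type OLIVE with these parameters terminates, outputs a $C_1\epsilon$-optimal policy, and uses at most $C_2\,H^3d^2|\mathcal A|\log(|\mathcal F|)\,\iota/\epsilon^2$ episodes in total. -/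

import Mathlib

open MeasureTheory ProbabilityTheory

universe u v

noncomputable section

namespace VOlive

/-! ### Episodic Markov decision processes

Steps are numbered `0, 1, …, H - 1` (step `h` here is step `h + 1` in the usual numbering).
Transitions, rewards and policies are indexed by `ℕ`; entries with index `≥ H` play no role. -/

/-- An episodic MDP with horizon `H`, deterministic non-negative rewards whose sum along any
sequence of states and actions is at most `1`, and a fixed initial state. -/
structure MDP (S : Type u) (A : Type v) [MeasurableSpace S] [MeasurableSpace A] (H : ℕ) where
  P : ℕ → Kernel (S × A) S
  markov : ∀ h, IsMarkovKernel (P h)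
  r : ℕ → S → A → ℝ
  measurable_r : ∀ h, Measurable (fun p : S × A => r h p.1 p.2)
  r_nonneg : ∀ h s a, 0 ≤ r h s a
  r_sum_le_one : ∀ (s : ℕ → S) (a : ℕ → A), ∑ h ∈ Finset.range H, r h (s h) (a h) ≤ 1
  init : S

/-- A deterministic (measurable) policy. -/
structure Policy (S : Type u) (A : Type v) [MeasurableSpace S] [MeasurableSpace A] where
  act : ℕ → S → A
  measurable_act : ∀ h, Measurable (act h)

variable {S : Type u} {A : Type v} [MeasurableSpace S] [MeasurableSpace A] {H : ℕ}

/-- A deterministic policy as a sequence of kernels from states to actions. -/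
def Policy.kernel (π : Policy S A) (h : ℕ) : Kernel S A :=
  Kernel.deterministic (π.act h) (π.measurable_act h)

/-- The transition tuple `(s_h, a_h, s_{h+1})` observed at one step. The reward is the
deterministic quantity `r_h(s_h, a_h)`, so it is not stored. -/
abbrev Tuple (S : Type u) (A : Type v) : Type (max u v) := S × A × S

/-- Law of `(s_h, a_h, s_{h+1})` given `s_h`, when `a_h ∼ κ_h(· ∣ s_h)`. -/
def MDP.stepLaw (M : MDP S A H) (κ : ℕ → Kernel S A) (h : ℕ) : Kernel S (Tuple S A) :=
  Kernel.id ×ₖ (κ h ⊗ₖ M.P h)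

/-- Law of the `n` successive tuples of steps `h, …, h + n - 1`, given `s_h`, when the actions
are drawn from the (possibly randomized) Markov policy `κ`. -/
def MDP.trajLaw (M : MDP S A H) (κ : ℕ → Kernel S A) :
    (n : ℕ) → (h : ℕ) → Kernel S (Fin n → Tuple S A)
  | 0, _ => Kernel.const S (Measure.dirac Fin.elim0)
  | n + 1, h =>
      ((M.stepLaw κ h) ⊗ₖ
        ((MDP.trajLaw M κ n (h + 1)).comap (fun p : S × Tuple S A => p.2.2.2)
          (by fun_prop))).map
        (fun q => (Fin.cons q.1 q.2 : Fin (n + 1) → Tuple S A))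

/-- A full episode: the tuples of the steps `0, …, H - 1`. -/
abbrev Episode (S : Type u) (A : Type v) (H : ℕ) : Type (max u v) := Fin H → Tuple S A

/-- Law of an episode from the initial state under the Markov policy `κ`. -/
def MDP.episodeLaw (M : MDP S A H) (κ : ℕ → Kernel S A) : Measure (Episode S A H) :=
  M.trajLaw κ H 0 M.init

/-- Expected sum of the rewards of the steps `h, …, H - 1` when `s_h = s` and actions are drawn
from `κ`. -/
def MDP.expReward (M : MDP S A H) (κ : ℕ → Kernel S A) (h : ℕ) (s : S) : ℝ :=
  ∫ τ, ∑ i : Fin (H - h), M.r (h + i) (τ i).1 (τ i).2.1 ∂(M.trajLaw κ (H - h) h s)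

/-- `V_h^π(s)`. -/
def MDP.value (M : MDP S A H) (π : Policy S A) (h : ℕ) (s : S) : ℝ :=
  M.expReward π.kernel h s

/-- `Q_h^π(s, a)`: the action `a` is taken at step `h`, and `π` is followed afterwards. -/
def MDP.qValue (M : MDP S A H) (π : Policy S A) (h : ℕ) (s : S) (a : A) : ℝ :=
  M.expReward (Function.update π.kernel h (Kernel.const S (Measure.dirac a))) h s

/-- `V_h^⋆(s) = sup_π V_h^π(s)`. -/
def MDP.valueStar (M : MDP S A H) (h : ℕ) (s : S) : ℝ :=
  ⨆ π : Policy S A, M.value π h s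

/-- `Q_h^⋆(s, a) = sup_π Q_h^π(s, a)`. -/
def MDP.qStar (M : MDP S A H) (h : ℕ) (s : S) (a : A) : ℝ :=
  ⨆ π : Policy S A, M.qValue π h s a

/-- `π` is `ε`-optimal. -/
def MDP.IsOptimalUpTo (M : MDP S A H) (ε : ℝ) (π : Policy S A) : Prop :=
  M.valueStar 0 M.init - ε ≤ M.value π 0 M.init

/-! ### Function classes, greedy policies, Bellman residuals -/

/-- A candidate `f = (f_h)_{h < H}`. -/
abbrev QFun (S : Type u) (A : Type v) (H : ℕ) : Type (max u v) := Fin H → S → A → ℝ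

/-- The component `f_h`, with the convention that it is `0` past the last step. -/
def QFun.at (f : QFun S A H) (h : ℕ) : S → A → ℝ :=
  if hh : h < H then f ⟨h, hh⟩ else 0

/-- The product class `F_0 × ⋯ × F_{H-1}`. -/
def productClass (F : Fin H → Set (S → A → ℝ)) : Set (QFun S A H) := Set.univ.pi F

/-- `π` is greedy for `f`: `π_h(s) ∈ argmax_a f_h(s, a)`. -/
def IsGreedy (f : QFun S A H) (π : Policy S A) : Prop :=
  ∀ (h : Fin H) (s : S) (a : A), f h s a ≤ f h s (π.act h s)

/-- The Bellman operator `(T_h g)(s, a) = r_h(s, a) + E_{s' ∼ P_h(· ∣ s, a)} max_{a'} g(s', a')`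
(the supremum is a maximum for finite `A`). -/
def MDP.bellman (M : MDP S A H) (h : ℕ) (g : S → A → ℝ) (s : S) (a : A) : ℝ :=
  M.r h s a + ∫ s', (⨆ a', g s' a') ∂(M.P h (s, a))

/-- The state-wise Bellman residual `s ↦ (f_h - T_h f_{h+1})(s, π_f(s))`, where `π_f = gr f`. -/
def MDP.vResidual (M : MDP S A H) (gr : QFun S A H → Policy S A) (f : QFun S A H) (h : Fin H)
    (s : S) : ℝ :=
  f h s ((gr f).act h s) - M.bellman h (f.at (h + 1)) s ((gr f).act h s)

/-- The class `(I - T_h) V_F` of state-wise Bellman residuals. -/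
def MDP.vResidualClass (M : MDP S A H) (gr : QFun S A H → Policy S A) (F : Set (QFun S A H))
    (h : Fin H) : Set (S → ℝ) :=
  {g | ∃ f ∈ F, g = M.vResidual gr f h}

/-- The family `D_{F,h}` of the laws of the state `s_h` under the greedy policies of `F`. -/
def MDP.rollIn (M : MDP S A H) (gr : QFun S A H → Policy S A) (F : Set (QFun S A H))
    (h : Fin H) : Set (Measure S) :=
  {μ | ∃ f ∈ F, μ = (M.episodeLaw (gr f).kernel).map (fun τ => (τ h).1)}

/-! ### Distributional Eluder dimension and V-type Bellman Eluder dimension -/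

/-- `ν` is `ε`-independent of `μ_0, …, μ_{n-1}` with respect to `G`. -/
def EpsIndependent {X : Type*} [MeasurableSpace X] (G : Set (X → ℝ)) (ε : ℝ) {n : ℕ}
    (μ : Fin n → Measure X) (ν : Measure X) : Prop :=
  ∃ g ∈ G, Real.sqrt (∑ i, (∫ x, g x ∂(μ i)) ^ 2) ≤ ε ∧ ε < |∫ x, g x ∂ν|

/-- The distributional Eluder dimension: the supremum of the lengths `n` of sequences in `Pi`
for which some `ε' ≥ ε` makes every element `ε'`-independent of its predecessors. -/
def deDim {X : Type*} [MeasurableSpace X] (G : Set (X → ℝ)) (Pi : Set (Measure X)) (ε : ℝ) :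
    ℕ∞ :=
  ⨆ n ∈ {n : ℕ | ∃ ρ : ℕ → Measure X, (∀ i < n, ρ i ∈ Pi) ∧
    ∃ ε' ≥ ε, ∀ i < n, EpsIndependent G ε' (fun j : Fin i => ρ j) (ρ i)}, (n : ℕ∞)

/-- The V-type `ε`-Bellman Eluder dimension of `F` with respect to `D_F`. -/
def MDP.vbeDim (M : MDP S A H) (gr : QFun S A H → Policy S A) (F : Set (QFun S A H)) (ε : ℝ) :
    ℕ∞ :=
  ⨆ h : Fin H, deDim (M.vResidualClass gr F h) (M.rollIn gr F h) ε

/-! ### The V-type OLIVE algorithm -/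

/-- The parameters of the algorithm. -/
structure Params where
  zetaAct : ℝ
  zetaElim : ℝ
  nAct : ℕ
  nElim : ℕ

/-- A data set of `n` episodes. -/
abbrev Data (S : Type u) (A : Type v) (H n : ℕ) : Type (max u v) := Fin n → Episode S A H

/-- The law of `n` independent episodes under `κ`. -/
def MDP.dataLaw (M : MDP S A H) (κ : ℕ → Kernel S A) (n : ℕ) : Measure (Data S A H n) :=
  Measure.pi (fun _ => M.episodeLaw κ)

/-- The temporal difference `f_h(s, a) - r_h(s, a) - max_{a'} f_{h+1}(s', a')`. -/
def MDP.tdError (M : MDP S A H) (f : QFun S A H) (h : Fin H) (z : Tuple S A) : ℝ :=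
  f h z.1 z.2.1 - M.r h z.1 z.2.1 - ⨆ a', f.at (h + 1) z.2.2 a'

/-- The on-policy estimate of the Bellman error, used for activation. -/
def MDP.actEstimate (M : MDP S A H) {n : ℕ} (f : QFun S A H) (h : Fin H) (D : Data S A H n) : ℝ :=
  (1 / (n : ℝ)) * ∑ i, M.tdError f h (D i h)

open Classical in
/-- The importance-weighted estimate of the V-type Bellman error, used for elimination. -/
def MDP.elimEstimate [Fintype A] (M : MDP S A H) {n : ℕ} (gr : QFun S A H → Policy S A)
    (f : QFun S A H) (h : Fin H) (D : Data S A H n) : ℝ :=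
  (1 / (n : ℝ)) * ∑ i,
    (if (D i h).2.1 = (gr f).act h (D i h).1 then 1 else 0) / (1 / (Fintype.card A : ℝ)) *
      M.tdError f h (D i h)

/-- Follow `π`, except that the action of step `t` is uniformly random. -/
def explore [Fintype A] [Nonempty A] (π : Policy S A) (t : ℕ) : ℕ → Kernel S A :=
  Function.update π.kernel t (Kernel.const S (PMF.uniformOfFintype A).toMeasure)

/-- State of a run: either it has not terminated yet, or it has terminated with an output
policy after a total number of executed episodes. -/
inductive Outcome (S : Type u) (A : Type v) [MeasurableSpace S] [MeasurableSpace A] where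
  | running : Outcome S A
  | done (output : Policy S A) (episodes : ℕ) : Outcome S A

instance : MeasurableSpace (Outcome S A) := ⊤

/-- The choices which the pseudocode leaves open: the maximizer `f^k` over the current version
space, and the step `t` at which the elimination takes place. They may depend on the phase, on the
current version space and, for `t`, on the data collected in the current phase. -/
structure Choices (S : Type u) (A : Type v) (H n : ℕ) where
  optimist : ℕ → Set (QFun S A H) → QFun S A H
  pick : ℕ → Set (QFun S A H) → Data S A H n → Fin H

/-- The choices respect the pseudocode: `f^k` maximizes `f_1(s_1, π_f(s_1))` over the version space,
and the estimated Bellman error at the picked step exceeds `ζ_act` as soon as there is such a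
step. -/
structure Choices.Valid (M : MDP S A H) (gr : QFun S A H → Policy S A) (F : Set (QFun S A H))
    (p : Params) (ch : Choices S A H p.nAct) : Prop where
  optimist_mem : ∀ k B, B ⊆ F → B.Nonempty → ch.optimist k B ∈ B
  optimist_max : ∀ k B, B ⊆ F → B.Nonempty → ∀ g ∈ B,
    g.at 0 M.init ((gr g).act 0 M.init) ≤
      (ch.optimist k B).at 0 M.init ((gr (ch.optimist k B)).act 0 M.init)
  measurable_pick : ∀ k B, B ⊆ F → B.Nonempty → Measurable (ch.pick k B)
  pick_spec : ∀ k B, B ⊆ F → B.Nonempty → ∀ D : Data S A H p.nAct,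
    (∃ t, p.zetaAct < M.actEstimate (ch.optimist k B) t D) →
      p.zetaAct < M.actEstimate (ch.optimist k B) (ch.pick k B D) D

/-- Law of the state of V-type OLIVE after at most `N` further phases, when it is about to start
phase `k` with version space `B`, having used `m` episodes so far. -/
def MDP.oliveLaw [Fintype A] [Nonempty A] (M : MDP S A H) (gr : QFun S A H → Policy S A)
    (p : Params) (ch : Choices S A H p.nAct) :
    (N : ℕ) → (k : ℕ) → (B : Set (QFun S A H)) → (m : ℕ) → Measure (Outcome S A)
  | 0, _, _, _ => Measure.dirac Outcome.running
  | N + 1, k, B, m =>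
      let f := ch.optimist k B
      let π := gr f
      (M.dataLaw π.kernel p.nAct).bind fun D =>
        if ∑ h, M.actEstimate f h D ≤ H * p.zetaAct then
          Measure.dirac (Outcome.done π (m + p.nAct))
        else
          let t := ch.pick k B D
          (M.dataLaw (explore π t) p.nElim).bind fun D' =>
            MDP.oliveLaw M gr p ch N (k + 1)
              {g ∈ B | |M.elimEstimate gr g t D'| ≤ p.zetaElim} (m + p.nAct + p.nElim)

/-- Probability that V-type OLIVE, started with version space `F`, terminates with an output
policy and a total number of episodes that satisfy `E`. (The events "terminated within `N` phases
with such an outcome" increase with `N`.) -/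
def MDP.oliveProb [Fintype A] [Nonempty A] (M : MDP S A H) (gr : QFun S A H → Policy S A)
    (F : Set (QFun S A H)) (p : Params) (ch : Choices S A H p.nAct)
    (E : Policy S A → ℕ → Prop) : ENNReal :=
  ⨆ N : ℕ, M.oliveLaw gr p ch N 1 F 0 {o | ∃ π n, o = Outcome.done π n ∧ E π n}

/-- `ι = c log (H d |A| / (δ ε))`, with `nA` the number of actions. -/
def iota (c : ℝ) (H d nA : ℕ) (δ ε : ℝ) : ℝ :=
  c * Real.log ((H : ℝ) * d * nA / (δ * ε))

/-- The choice of parameters, with sample sizes rounded up; `nA` is the number of actions and `nF`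
the cardinality of the function class. -/
def oliveParams (c : ℝ) (H d nA nF : ℕ) (δ ε : ℝ) : Params where
  zetaAct := 2 * ε / H
  zetaElim := ε / (2 * H * Real.sqrt d)
  nAct := ⌈(H : ℝ) ^ 2 * iota c H d nA δ ε / ε ^ 2⌉₊
  nElim := ⌈(H : ℝ) ^ 2 * d * nA * Real.log nF * iota c H d nA δ ε / ε ^ 2⌉₊

end VOlive

end

open VOlive

/-!
The temporal-difference errors are bounded by `2`, and the importance-weighted ones have second
moment at most `4 |A|`, so by Bernstein's inequality and a union bound the estimates of each of
the first `H d + 1` phases are accurate with high probability; the activation estimates are then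
within `ε / H`, and the elimination estimates within `ζ_elim`, of the mean Bellman residuals.

As long as the estimates are accurate, `Q^⋆` is never eliminated, because its residual vanishes.
Hence the selected candidate is optimistic, and the loss of its greedy policy is at most the sum
over the steps of its mean residuals under its own roll-in. Termination thus certifies a loss of
at most `3 ε`. A phase that does not terminate has mean residual above `ε / H` at the picked step,
while its candidate survived the earlier eliminations at that step and so has residuals of size at
most `2 ζ_elim` under the `n ≤ d` earlier roll-in laws. Since `√d · 2 ζ_elim = ε / H`, the new
roll-in law is independent of those in the sense of the distributional Eluder dimension. So each
step is picked at most `d` times, and the run ends within `H d + 1` phases.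
-/

namespace VOlive

/-! ### Concentration -/

section Concentration

variable {Ω : Type*} [MeasurableSpace Ω] {μ : Measure Ω}

lemma mgf_le_exp_of_abs_le [IsProbabilityMeasure μ] {X : Ω → ℝ} {b l : ℝ}
    (hX : AEMeasurable X μ) (hb : ∀ᵐ ω ∂μ, |X ω| ≤ b) (hlb : |l| * b ≤ 1) :
    mgf X μ l ≤ Real.exp (l * ∫ ω, X ω ∂μ + l ^ 2 * ∫ ω, X ω ^ 2 ∂μ) := by
  have hXi : Integrable X μ := .of_bound hX.aestronglyMeasurable b hb
  have hX2 : Integrable (fun ω => X ω ^ 2) μ := by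
    refine .of_bound (hX.pow_const 2).aestronglyMeasurable (b ^ 2) (hb.mono fun ω hω => ?_)
    rw [Real.norm_eq_abs, abs_pow]
    exact pow_le_pow_left₀ (abs_nonneg _) hω 2
  have hsmall : ∀ᵐ ω ∂μ, |l * X ω| ≤ 1 := hb.mono fun ω hω => by
    rw [abs_mul]
    exact (mul_le_mul_of_nonneg_left hω (abs_nonneg l)).trans hlb
  have hexp : Integrable (fun ω => Real.exp (l * X ω)) μ := by
    refine .of_bound (by fun_prop) (Real.exp 1) (hsmall.mono fun ω hω => ?_)
    rw [Real.norm_eq_abs, Real.abs_exp]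
    exact Real.exp_le_exp.2 ((le_abs_self _).trans hω)
  have hlin : Integrable (fun ω => 1 + l * X ω) μ := (integrable_const 1).add (hXi.const_mul l)
  calc mgf X μ l ≤ ∫ ω, (1 + l * X ω + l ^ 2 * X ω ^ 2) ∂μ := by
        refine integral_mono_ae hexp (hlin.add (hX2.const_mul (l ^ 2))) (hsmall.mono fun ω hω => ?_)
        have := (abs_le.1 (Real.abs_exp_sub_one_sub_id_le hω)).2
        simp only
        linarith [mul_pow l (X ω) 2]
    _ = (l * ∫ ω, X ω ∂μ + l ^ 2 * ∫ ω, X ω ^ 2 ∂μ) + 1 := by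
        rw [integral_add hlin (hX2.const_mul _),
          integral_add (integrable_const 1) (hXi.const_mul l), integral_const_mul,
          integral_const_mul, integral_const, probReal_univ, one_smul]
        ring
    _ ≤ _ := Real.add_one_le_exp _

section Bernstein

variable {ι : Type*} {X : ι → Ω → ℝ} {s : Finset ι} {b V t : ℝ}

lemma integrable_exp_mul_sum_of_abs_le [IsFiniteMeasure μ] (hX : ∀ i, AEMeasurable (X i) μ)
    (hb : ∀ i ∈ s, ∀ᵐ ω ∂μ, |X i ω| ≤ b) (l : ℝ) :
    Integrable (fun ω => Real.exp (l * (∑ i ∈ s, X i) ω)) μ := by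
  refine .of_bound (by fun_prop) (Real.exp (|l| * ∑ _i ∈ s, b)) ?_
  filter_upwards [(Filter.eventually_all_finset s).2 hb] with ω hω
  rw [Real.norm_eq_abs, Real.abs_exp, Finset.sum_apply]
  refine Real.exp_le_exp.2 ((le_abs_self _).trans ?_)
  rw [abs_mul]
  exact mul_le_mul_of_nonneg_left
    ((Finset.abs_sum_le_sum_abs _ _).trans (Finset.sum_le_sum hω)) (abs_nonneg l)

lemma measureReal_le_sum_sub_integral_le (hind : iIndepFun X μ)
    (hX : ∀ i, AEMeasurable (X i) μ) (hb : ∀ i ∈ s, ∀ᵐ ω ∂μ, |X i ω| ≤ b)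
    (hV : ∑ i ∈ s, ∫ ω, X i ω ^ 2 ∂μ ≤ V) (hV0 : 0 < V) (ht : 0 ≤ t) (htb : t * b ≤ 2 * V) :
    μ.real {ω | t ≤ ∑ i ∈ s, (X i ω - ∫ ω, X i ω ∂μ)} ≤ Real.exp (-(t ^ 2 / (4 * V))) := by
  have := hind.isProbabilityMeasure
  -- The minimizer of the exponent `-l t + l² V` left by the Chernoff bound.
  set l := t / (2 * V) with hl
  have hl0 : 0 ≤ l := by positivity
  have hlb : |l| * b ≤ 1 := by
    rw [abs_of_nonneg hl0, hl, div_mul_eq_mul_div]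
    exact (div_le_one (by positivity)).2 htb
  set m := ∑ i ∈ s, ∫ ω, X i ω ∂μ with hm
  have hset : {ω | t ≤ ∑ i ∈ s, (X i ω - ∫ ω, X i ω ∂μ)} = {ω | t + m ≤ (∑ i ∈ s, X i) ω} := by
    ext ω
    rw [Set.mem_ofPred_eq, Set.mem_ofPred_eq, Finset.sum_sub_distrib, Finset.sum_apply,
      le_sub_iff_add_le]
  calc μ.real {ω | t ≤ ∑ i ∈ s, (X i ω - ∫ ω, X i ω ∂μ)}
      ≤ Real.exp (-l * (t + m)) * mgf (∑ i ∈ s, X i) μ l :=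
        hset ▸ measure_ge_le_exp_mul_mgf _ hl0 (integrable_exp_mul_sum_of_abs_le hX hb l)
    _ ≤ Real.exp (-l * (t + m)) *
          ∏ i ∈ s, Real.exp (l * ∫ ω, X i ω ∂μ + l ^ 2 * ∫ ω, X i ω ^ 2 ∂μ) := by
        rw [hind.mgf_sum₀ hX]
        gcongr with i hi
        · exact fun _ _ => mgf_nonneg
        · exact mgf_le_exp_of_abs_le (hX i) (hb i hi) hlb
    _ = Real.exp (-l * t + l ^ 2 * ∑ i ∈ s, ∫ ω, X i ω ^ 2 ∂μ) := by
        rw [← Real.exp_sum, ← Real.exp_add, Finset.sum_add_distrib, ← Finset.mul_sum,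
          ← Finset.mul_sum, ← hm]
        ring_nf
    _ ≤ Real.exp (-l * t + l ^ 2 * V) := by gcongr
    _ = Real.exp (-(t ^ 2 / (4 * V))) := by
        rw [hl]
        field_simp
        ring_nf

lemma measureReal_le_abs_sum_sub_integral_le (hind : iIndepFun X μ)
    (hX : ∀ i, AEMeasurable (X i) μ) (hb : ∀ i ∈ s, ∀ᵐ ω ∂μ, |X i ω| ≤ b)
    (hV : ∑ i ∈ s, ∫ ω, X i ω ^ 2 ∂μ ≤ V) (hV0 : 0 < V) (ht : 0 ≤ t) (htb : t * b ≤ 2 * V) :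
    μ.real {ω | t ≤ |∑ i ∈ s, (X i ω - ∫ ω, X i ω ∂μ)|} ≤
      2 * Real.exp (-(t ^ 2 / (4 * V))) := by
  have := hind.isProbabilityMeasure
  have hupper := measureReal_le_sum_sub_integral_le hind hX hb hV hV0 ht htb
  have hlower := measureReal_le_sum_sub_integral_le (X := fun i ω => -X i ω) (s := s)
    (hind.comp (fun _ x => -x) fun _ => measurable_neg) (fun i => (hX i).neg)
    (by simpa only [abs_neg] using hb) (by simpa only [neg_sq] using hV) hV0 ht htb
  have hset : {ω | t ≤ |∑ i ∈ s, (X i ω - ∫ ω, X i ω ∂μ)|} =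
      {ω | t ≤ ∑ i ∈ s, (X i ω - ∫ ω, X i ω ∂μ)} ∪
        {ω | t ≤ ∑ i ∈ s, (-X i ω - ∫ ω, -X i ω ∂μ)} := by
    ext ω
    simp only [Set.mem_ofPred_eq, Set.mem_union, le_abs, integral_neg, ← Finset.sum_neg_distrib,
      neg_sub, neg_sub_neg]
  rw [hset, two_mul]
  exact (measureReal_union_le _ _).trans (add_le_add hupper hlower)

end Bernstein

/-- The average of `X` over the sample `D`; it is `0` for the empty sample. -/
noncomputable def empiricalMean {n : ℕ} (X : Ω → ℝ) (D : Fin n → Ω) : ℝ :=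
  (1 / (n : ℝ)) * ∑ i, X (D i)

lemma measure_lt_abs_empiricalMean_sub_integral_le [IsProbabilityMeasure μ] {X : Ω → ℝ}
    {b v t : ℝ} {n : ℕ} (hX : AEMeasurable X μ) (hb : ∀ᵐ ω ∂μ, |X ω| ≤ b)
    (hv : ∫ ω, X ω ^ 2 ∂μ ≤ v) (hv0 : 0 < v) (ht : 0 ≤ t) (htb : t * b ≤ 2 * v) :
    Measure.pi (fun _ : Fin n => μ) {D | t < |empiricalMean X D - ∫ ω, X ω ∂μ|} ≤
      ENNReal.ofReal (2 * Real.exp (-(n * t ^ 2 / (4 * v)))) := by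
  rcases n.eq_zero_or_pos with rfl | hn
  · refine prob_le_one.trans (ENNReal.one_le_ofReal.2 ?_)
    norm_num
  have hn' : (0 : ℝ) < n := mod_cast hn
  have hmp (i : Fin n) := measurePreserving_eval (fun _ : Fin n => μ) i
  have hmean (i : Fin n) : ∫ D, X (D i) ∂Measure.pi (fun _ : Fin n => μ) = ∫ ω, X ω ∂μ :=
    integral_comp_eval hX.aestronglyMeasurable
  have hsq (i : Fin n) : ∫ D, X (D i) ^ 2 ∂Measure.pi (fun _ : Fin n => μ) = ∫ ω, X ω ^ 2 ∂μ :=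
    integral_comp_eval (μ := fun _ : Fin n => μ) (f := fun ω => X ω ^ 2)
      (hX.pow_const 2).aestronglyMeasurable
  have hdev := measureReal_le_abs_sum_sub_integral_le (s := Finset.univ) (b := b) (V := n * v)
    (t := n * t) (iIndepFun_pi fun _ : Fin n => hX)
    (fun i => hX.comp_quasiMeasurePreserving (hmp i).quasiMeasurePreserving)
    (fun i _ => (hmp i).quasiMeasurePreserving.ae hb)
    (by
      rw [Finset.sum_congr rfl fun i _ => hsq i, Finset.sum_const, Finset.card_fin, nsmul_eq_mul]
      gcongr)
    (by positivity) (by positivity) (by nlinarith)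
  rw [← ofReal_measureReal]
  refine ENNReal.ofReal_le_ofReal ((measureReal_mono fun D hD => ?_).trans (hdev.trans_eq ?_))
  · have hscale : ∑ i, (X (D i) - ∫ ω, X ω ∂μ) = n * (empiricalMean X D - ∫ ω, X ω ∂μ) := by
      rw [Finset.sum_sub_distrib, Finset.sum_const, Finset.card_fin, nsmul_eq_mul, empiricalMean]
      field_simp
    simp only [Set.mem_ofPred_eq, hmean] at hD ⊢
    rw [hscale, abs_mul, abs_of_pos hn']
    gcongr
  · congr 3
    field_simp

lemma ofReal_one_sub_add_le_lintegral [IsProbabilityMeasure μ] {f : Ω → ENNReal} {Bad : Set Ω}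
    {x y : ℝ} (hx : 0 ≤ x) (hy : 0 ≤ y) (hBad : μ Bad ≤ ENNReal.ofReal y)
    (hf : ∀ ω ∉ Bad, ENNReal.ofReal (1 - x) ≤ f ω) :
    ENNReal.ofReal (1 - (x + y)) ≤ ∫⁻ ω, f ω ∂μ := by
  rcases lt_or_ge (1 - x) 0 with hx1 | hx1
  · rw [ENNReal.ofReal_of_nonpos (by linarith)]
    exact zero_le
  set T := toMeasurable μ Bad
  have hT : MeasurableSet T := measurableSet_toMeasurable μ Bad
  have hTc : ENNReal.ofReal (1 - y) ≤ μ Tᶜ := by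
    rw [prob_compl_eq_one_sub hT, measure_toMeasurable, ENNReal.ofReal_sub _ hy,
      ENNReal.ofReal_one]
    exact tsub_le_tsub_left hBad 1
  calc ENNReal.ofReal (1 - (x + y)) ≤ ENNReal.ofReal ((1 - x) * (1 - y)) :=
        ENNReal.ofReal_le_ofReal (by nlinarith)
    _ = ENNReal.ofReal (1 - x) * ENNReal.ofReal (1 - y) := ENNReal.ofReal_mul hx1
    _ ≤ ENNReal.ofReal (1 - x) * μ Tᶜ := by gcongr
    _ = ∫⁻ _ in Tᶜ, ENNReal.ofReal (1 - x) ∂μ := (setLIntegral_const _ _).symm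
    _ ≤ ∫⁻ ω in Tᶜ, f ω ∂μ :=
        setLIntegral_mono' hT.compl fun ω hω => hf ω fun hB => hω (subset_toMeasurable μ Bad hB)
    _ ≤ ∫⁻ ω, f ω ∂μ := setLIntegral_le_lintegral _ _

lemma measure_exists_mem_le_ofReal {ι : Type*} {s : Finset ι} {p : ι → Ω → Prop} {y : ℝ}
    (hp : ∀ i ∈ s, μ {ω | p i ω} ≤ ENNReal.ofReal y) :
    μ {ω | ∃ i ∈ s, p i ω} ≤ ENNReal.ofReal (s.card * y) := by
  have hUnion : {ω | ∃ i ∈ s, p i ω} = ⋃ i ∈ s, {ω | p i ω} := by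
    ext ω
    simp only [Set.mem_ofPred_eq, Set.mem_iUnion, exists_prop]
  rw [hUnion, ENNReal.ofReal_mul (Nat.cast_nonneg _), ENNReal.ofReal_natCast, ← nsmul_eq_mul]
  exact (measure_biUnion_finset_le s _).trans (Finset.sum_le_card_nsmul s _ _ hp)

lemma measurable_comp_sep {Y Z : Type*} [MeasurableSpace Z] {B : Set Y} (hB : B.Finite)
    {p : Y → Ω → Prop} (hp : ∀ y ∈ B, MeasurableSet {ω | p y ω}) (G : Set Y → Z) :
    Measurable fun ω => G {y ∈ B | p y ω} := by
  have := hB.to_subtype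
  have hpattern : Measurable fun (ω : Ω) (y : B) => p y ω :=
    measurable_pi_lambda _ fun y => measurableSet_setOfPred.1 (hp y y.2)
  have hcomp := (Measurable.of_discrete
    (f := fun q : B → Prop => G (Subtype.val '' {y | q y}))).comp hpattern
  convert hcomp using 1
  funext ω
  simp only [Function.comp_apply]
  congr 1
  ext y
  simp only [Set.mem_ofPred_eq, Set.mem_image, Subtype.exists, exists_and_right, exists_eq_right,
    exists_prop]

end Concentration

/-! ### Laws of states and episodes -/

variable {S : Type u} {A : Type v} [MeasurableSpace S] [MeasurableSpace A] {H : ℕ}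

lemma abs_integral_le_of_abs_le {X : Type*} [MeasurableSpace X] {μ : Measure X}
    [IsProbabilityMeasure μ] {φ : X → ℝ} {b : ℝ} (hb : ∀ᵐ x ∂μ, |φ x| ≤ b) :
    |∫ x, φ x ∂μ| ≤ b := by
  simpa only [Real.norm_eq_abs, probReal_univ, mul_one] using
    norm_integral_le_of_norm_le_const (f := φ) hb

lemma measurable_fin_cons {n : ℕ} {X : Type*} [MeasurableSpace X] :
    Measurable fun q : X × (Fin n → X) => (Fin.cons q.1 q.2 : Fin (n + 1) → X) :=
  measurable_pi_lambda _ fun i => by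
    cases i using Fin.cases with
    | zero => simpa only [Fin.cons_zero] using measurable_fst
    | succ j => simp only [Fin.cons_succ]; fun_prop

lemma dirac_compProd {X Y : Type*} [MeasurableSpace X] [MeasurableSpace Y] (η : Kernel X Y)
    [IsSFiniteKernel η] (x : X) : (Measure.dirac x) ⊗ₘ η = (η x).map (Prod.mk x) := by
  ext T hT
  rw [Measure.compProd_apply hT, lintegral_dirac' _ (Kernel.measurable_kernel_prodMk_left hT),
    Measure.map_apply measurable_prodMk_left hT]

instance (π : Policy S A) (h : ℕ) : IsMarkovKernel (π.kernel h) := by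
  unfold Policy.kernel
  infer_instance

lemma Policy.kernel_apply (π : Policy S A) (h : ℕ) (s : S) :
    π.kernel h s = Measure.dirac (π.act h s) :=
  Kernel.deterministic_apply (π.measurable_act h) s

instance (κ : ℕ → Kernel S A) [∀ h, IsMarkovKernel (κ h)] (t : ℕ) (η : Kernel S A)
    [IsMarkovKernel η] (h : ℕ) : IsMarkovKernel (Function.update κ t η h) := by
  rcases eq_or_ne h t with rfl | hne
  · rwa [Function.update_self]
  · rw [Function.update_of_ne hne]
    infer_instance

namespace MDP

variable (M : MDP S A H)

instance (h : ℕ) : IsMarkovKernel (M.P h) := M.markov h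

/-- The transition kernel of the state process at step `h` when actions are drawn from `κ`. -/
noncomputable def transKernel (κ : ℕ → Kernel S A) (h : ℕ) : Kernel S S :=
  (M.stepLaw κ h).map fun z => z.2.2

/-- The law of the state `s_{h+i}` given `s_h` when actions are drawn from `κ`. -/
noncomputable def stateLaw (κ : ℕ → Kernel S A) : ℕ → ℕ → Kernel S S
  | 0, _ => Kernel.id
  | i + 1, h => stateLaw κ i (h + 1) ∘ₖ M.transKernel κ h

lemma stateLaw_congr {κ κ' : ℕ → Kernel S A} (i h : ℕ)
    (hκ : ∀ j, h ≤ j → j < h + i → κ j = κ' j) : M.stateLaw κ i h = M.stateLaw κ' i h := by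
  induction i generalizing h with
  | zero => rfl
  | succ i ih =>
    simp only [stateLaw, transKernel, stepLaw]
    rw [ih (h + 1) fun j hj hji => hκ j (by omega) (by omega), hκ h le_rfl (by omega)]

lemma trajLaw_congr {κ κ' : ℕ → Kernel S A} (n h : ℕ) (hκ : ∀ j, h ≤ j → κ j = κ' j) :
    M.trajLaw κ n h = M.trajLaw κ' n h := by
  induction n generalizing h with
  | zero => rfl
  | succ n ih =>
    simp only [trajLaw, stepLaw]
    rw [ih (h + 1) fun j hj => hκ j (by omega), hκ h le_rfl]

lemma stateLaw_succ_last (κ : ℕ → Kernel S A) (i h : ℕ) :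
    M.stateLaw κ (i + 1) h = M.transKernel κ (h + i) ∘ₖ M.stateLaw κ i h := by
  induction i generalizing h with
  | zero => simp only [stateLaw, Kernel.id_comp, Kernel.comp_id, add_zero]
  | succ i ih =>
    rw [stateLaw, ih, Kernel.comp_assoc, add_right_comm, add_assoc]
    rfl

variable (κ : ℕ → Kernel S A) [∀ h, IsMarkovKernel (κ h)]

instance (h : ℕ) : IsMarkovKernel (M.stepLaw κ h) := by
  unfold stepLaw
  infer_instance

instance (h : ℕ) : IsMarkovKernel (M.transKernel κ h) :=
  Kernel.IsMarkovKernel.map _ (by fun_prop)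

instance isMarkovKernel_trajLaw (n h : ℕ) : IsMarkovKernel (M.trajLaw κ n h) := by
  induction n generalizing h with
  | zero =>
    unfold trajLaw
    infer_instance
  | succ n ih =>
    have := ih (h + 1)
    exact Kernel.IsMarkovKernel.map _ measurable_fin_cons

instance isMarkovKernel_stateLaw (i h : ℕ) : IsMarkovKernel (M.stateLaw κ i h) := by
  induction i generalizing h with
  | zero =>
    unfold stateLaw
    infer_instance
  | succ i ih =>
    have := ih (h + 1)
    unfold stateLaw
    infer_instance

instance : IsProbabilityMeasure (M.episodeLaw κ) := by
  unfold episodeLaw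
  infer_instance

instance (n : ℕ) : IsProbabilityMeasure (M.dataLaw κ n) := by
  unfold dataLaw
  infer_instance

section OneStep

variable (h : ℕ) (s : S)

lemma stepLaw_apply :
    M.stepLaw κ h s = ((κ h s) ⊗ₘ (M.P h).sectR s).map (Prod.mk s) := by
  rw [stepLaw, Kernel.prod_apply, Kernel.id_apply, Measure.dirac_prod,
    Kernel.compProd_apply_eq_compProd_sectR]

lemma integral_stepLaw {φ : Tuple S A → ℝ} (hφ : Integrable φ (M.stepLaw κ h s)) :
    ∫ z, φ z ∂(M.stepLaw κ h s) = ∫ a, ∫ s', φ (s, a, s') ∂(M.P h (s, a)) ∂(κ h s) := by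
  rw [stepLaw_apply] at hφ ⊢
  rw [integral_map measurable_prodMk_left.aemeasurable hφ.aestronglyMeasurable]
  exact Measure.integral_compProd (hφ.comp_measurable measurable_prodMk_left)

variable {κ h s} {a : A} (ha : κ h s = Measure.dirac a)
include ha

lemma stepLaw_apply_of_dirac :
    M.stepLaw κ h s = (M.P h (s, a)).map fun s' => (s, a, s') := by
  rw [stepLaw_apply, ha, dirac_compProd, Kernel.sectR_apply,
    Measure.map_map measurable_prodMk_left measurable_prodMk_left]
  rfl

lemma transKernel_apply_of_dirac : M.transKernel κ h s = M.P h (s, a) := by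
  rw [transKernel, Kernel.map_apply _ (by fun_prop), M.stepLaw_apply_of_dirac ha,
    Measure.map_map (by fun_prop) (by fun_prop)]
  exact Measure.map_id

end OneStep

section Marginals

variable (h : ℕ)

lemma map_trajLaw_zero (n : ℕ) :
    (M.trajLaw κ (n + 1) h).map (fun τ => τ 0) = M.stepLaw κ h := by
  have hfst : (fun τ : Fin (n + 1) → Tuple S A => τ 0) ∘
      (fun q : Tuple S A × (Fin n → Tuple S A) => Fin.cons q.1 q.2) = Prod.fst :=
    funext fun q => Fin.cons_zero _ _
  rw [trajLaw, ← Kernel.map_comp_right _ measurable_fin_cons (by fun_prop), hfst,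
    ← Kernel.fst_eq, Kernel.fst_compProd]

lemma map_trajLaw_tail (n : ℕ) :
    (M.trajLaw κ (n + 1) h).map (fun τ i => τ (Fin.succ i)) =
      M.trajLaw κ n (h + 1) ∘ₖ M.transKernel κ h := by
  have hsnd : (fun (τ : Fin (n + 1) → Tuple S A) (i : Fin n) => τ i.succ) ∘
      (fun q : Tuple S A × (Fin n → Tuple S A) => Fin.cons q.1 q.2) = Prod.snd :=
    funext fun q => funext fun i => Fin.cons_succ _ _ _
  rw [trajLaw, ← Kernel.map_comp_right _ measurable_fin_cons (by fun_prop), hsnd,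
    ← Kernel.snd_eq]
  ext s T hT
  rw [Kernel.snd_apply' _ _ hT, Kernel.compProd_apply (measurable_snd hT),
    Kernel.comp_apply' _ _ _ hT, transKernel, Kernel.map_apply _ (by fun_prop),
    lintegral_map (Kernel.measurable_coe _ hT) (by fun_prop)]
  rfl

lemma map_trajLaw_eval {n : ℕ} (i : Fin n) :
    (M.trajLaw κ n h).map (fun τ => τ i) = M.stepLaw κ (h + i) ∘ₖ M.stateLaw κ i h := by
  induction n generalizing h with
  | zero => exact i.elim0
  | succ n ih =>
    cases i using Fin.cases with
    | zero => rw [map_trajLaw_zero, Fin.val_zero, add_zero, stateLaw, Kernel.comp_id]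
    | succ j =>
      have hcomp : (fun τ : Fin (n + 1) → Tuple S A => τ j.succ) =
          (fun τ => τ j) ∘ fun τ (i : Fin n) => τ i.succ := rfl
      rw [hcomp, Kernel.map_comp_right _ (by fun_prop) (by fun_prop), map_trajLaw_tail,
        Kernel.map_comp, ih, Fin.val_succ, stateLaw, Kernel.comp_assoc, add_right_comm h 1,
        add_assoc h]

lemma map_episodeLaw_eval (i : Fin H) :
    (M.episodeLaw κ).map (fun τ => τ i) = (M.stepLaw κ i ∘ₖ M.stateLaw κ i 0) M.init := by
  rw [episodeLaw, ← Kernel.map_apply _ (by fun_prop), map_trajLaw_eval, zero_add]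

lemma map_episodeLaw_state (i : Fin H) :
    (M.episodeLaw κ).map (fun τ => (τ i).1) = M.stateLaw κ i 0 M.init := by
  have hcomp : (fun τ : Episode S A H => (τ i).1) = Prod.fst ∘ fun τ => τ i := rfl
  have hstep : (M.stepLaw κ i).map Prod.fst = Kernel.id := by
    rw [← Kernel.fst_eq, stepLaw, Kernel.fst_prod]
  rw [hcomp, ← Measure.map_map (by fun_prop) (by fun_prop), map_episodeLaw_eval,
    ← Kernel.map_apply _ measurable_fst, Kernel.map_comp, hstep, Kernel.id_comp]

lemma integral_episodeLaw_eval (i : Fin H) {φ : Tuple S A → ℝ}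
    (hφ : Integrable φ ((M.episodeLaw κ).map fun τ => τ i)) :
    ∫ τ, φ (τ i) ∂(M.episodeLaw κ) =
      ∫ s, ∫ z, φ z ∂(M.stepLaw κ i s) ∂(M.stateLaw κ i 0 M.init) := by
  rw [← integral_map (measurable_pi_apply i).aemeasurable hφ.aestronglyMeasurable]
  rw [map_episodeLaw_eval] at hφ ⊢
  exact Kernel.integral_comp hφ

end Marginals

end MDP

/-! ### Value functions -/

namespace MDP

variable (M : MDP S A H)

lemma abs_r_le_one {h : ℕ} (hh : h < H) (s : S) (a : A) : |M.r h s a| ≤ 1 := by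
  rw [abs_of_nonneg (M.r_nonneg h s a)]
  exact (Finset.single_le_sum (f := fun i => M.r i s a) (fun i _ => M.r_nonneg i s a)
    (Finset.mem_range.2 hh)).trans (M.r_sum_le_one (fun _ => s) fun _ => a)

lemma measurable_r_tuple (h : ℕ) : Measurable fun z : Tuple S A => M.r h z.1 z.2.1 :=
  (M.measurable_r h).comp (f := fun z : Tuple S A => (z.1, z.2.1)) (by fun_prop)

lemma measurable_sum_r (h n : ℕ) :
    Measurable fun τ : Fin n → Tuple S A => ∑ i : Fin n, M.r (h + i) (τ i).1 (τ i).2.1 :=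
  Finset.measurable_fun_sum _ fun i _ =>
    (M.measurable_r_tuple (h + i)).comp (measurable_pi_apply i)

lemma abs_sum_r_le {h n : ℕ} (hn : h + n ≤ H) (τ : Fin n → Tuple S A) :
    |∑ i : Fin n, M.r (h + i) (τ i).1 (τ i).2.1| ≤ n := by
  refine (Finset.abs_sum_le_sum_abs _ _).trans ?_
  refine (Finset.sum_le_card_nsmul _ _ 1 fun i _ => M.abs_r_le_one (by omega) _ _).trans_eq ?_
  rw [Finset.card_univ, Fintype.card_fin, nsmul_one]

lemma measurable_expReward (κ : ℕ → Kernel S A) (h : ℕ) : Measurable (M.expReward κ h) :=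
  (M.measurable_sum_r h (H - h)).stronglyMeasurable.integral_kernel.measurable

lemma expReward_of_le (κ : ℕ → Kernel S A) {h : ℕ} (hh : H ≤ h) (s : S) :
    M.expReward κ h s = 0 := by
  rw [expReward, Nat.sub_eq_zero_of_le hh]
  simp only [Finset.univ_eq_empty, Finset.sum_empty, integral_zero]

variable (κ : ℕ → Kernel S A) [∀ h, IsMarkovKernel (κ h)]

lemma abs_expReward_le (h : ℕ) (s : S) : |M.expReward κ h s| ≤ H := by
  rcases le_or_gt H h with hh | hh
  · rw [M.expReward_of_le κ hh, abs_zero]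
    exact Nat.cast_nonneg _
  · exact (abs_integral_le_of_abs_le (.of_forall (M.abs_sum_r_le (by omega)))).trans
      (Nat.cast_le.2 (Nat.sub_le _ _))

lemma integrable_expReward (h : ℕ) (μ : Measure S) [IsFiniteMeasure μ] :
    Integrable (M.expReward κ h) μ :=
  .of_bound (M.measurable_expReward κ h).aestronglyMeasurable H
    (.of_forall (M.abs_expReward_le κ h))

lemma integral_sum_r_succ {h n : ℕ} (hn : h + (n + 1) ≤ H) (s : S) :
    ∫ τ, ∑ i : Fin (n + 1), M.r (h + i) (τ i).1 (τ i).2.1 ∂(M.trajLaw κ (n + 1) h s) =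
      ∫ z, M.r h z.1 z.2.1 ∂(M.stepLaw κ h s) +
        ∫ x, ∫ τ, ∑ i : Fin n, M.r (h + 1 + i) (τ i).1 (τ i).2.1 ∂(M.trajLaw κ n (h + 1) x)
          ∂(M.transKernel κ h s) := by
  have hshift : Measurable fun (τ : Fin (n + 1) → Tuple S A) (i : Fin n) => τ i.succ := by fun_prop
  have hhead : (M.trajLaw κ (n + 1) h s).map (fun τ => τ 0) = M.stepLaw κ h s := by
    rw [← Kernel.map_apply _ (by fun_prop), map_trajLaw_zero]
  have htail : (M.trajLaw κ (n + 1) h s).map (fun τ i => τ (Fin.succ i)) =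
      (M.trajLaw κ n (h + 1) ∘ₖ M.transKernel κ h) s := by
    rw [← Kernel.map_apply _ hshift, map_trajLaw_tail]
  have hheadInt : Integrable (fun z : Tuple S A => M.r h z.1 z.2.1) (M.stepLaw κ h s) :=
    .of_bound (M.measurable_r_tuple h).aestronglyMeasurable 1
      (.of_forall fun z => M.abs_r_le_one (by omega) z.1 z.2.1)
  have htailInt : Integrable (fun τ : Fin n → Tuple S A =>
      ∑ i : Fin n, M.r (h + 1 + i) (τ i).1 (τ i).2.1)
      ((M.trajLaw κ n (h + 1) ∘ₖ M.transKernel κ h) s) :=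
    .of_bound (M.measurable_sum_r (h + 1) n).aestronglyMeasurable n
      (.of_forall (M.abs_sum_r_le (by omega)))
  rw [← Kernel.integral_comp htailInt, ← hhead, ← htail,
    integral_map (measurable_pi_apply 0).aemeasurable
      (M.measurable_r_tuple h).aestronglyMeasurable,
    integral_map hshift.aemeasurable (M.measurable_sum_r (h + 1) n).aestronglyMeasurable]
  rw [← hhead] at hheadInt
  rw [← htail] at htailInt
  refine Eq.trans ?_ (integral_add (hheadInt.comp_measurable (measurable_pi_apply 0))
    (htailInt.comp_measurable hshift))
  simp only [Fin.sum_univ_succ, Fin.val_zero, Fin.val_succ, add_zero,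
    add_assoc, add_comm 1]

lemma expReward_eq_add {h : ℕ} (hh : h < H) (s : S) :
    M.expReward κ h s = ∫ z, M.r h z.1 z.2.1 ∂(M.stepLaw κ h s) +
      ∫ x, M.expReward κ (h + 1) x ∂(M.transKernel κ h s) := by
  unfold expReward
  rw [show H - h = H - (h + 1) + 1 by omega]
  exact M.integral_sum_r_succ κ (by omega) s

lemma expReward_of_dirac {κ : ℕ → Kernel S A} [∀ h, IsMarkovKernel (κ h)] {h : ℕ} (hh : h < H)
    {s : S} {a : A} (ha : κ h s = Measure.dirac a) :
    M.expReward κ h s = M.r h s a + ∫ x, M.expReward κ (h + 1) x ∂(M.P h (s, a)) := by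
  rw [M.expReward_eq_add κ hh, M.stepLaw_apply_of_dirac ha, M.transKernel_apply_of_dirac ha,
    integral_map (by fun_prop) (M.measurable_r_tuple h).aestronglyMeasurable]
  simp only [integral_const, probReal_univ, one_smul]

section Values

variable (π : Policy S A)

lemma value_of_le {h : ℕ} (hh : H ≤ h) (s : S) : M.value π h s = 0 :=
  M.expReward_of_le _ hh s

lemma integrable_value (h : ℕ) (μ : Measure S) [IsFiniteMeasure μ] :
    Integrable (M.value π h) μ :=
  M.integrable_expReward _ h μ

lemma value_eq_add {h : ℕ} (hh : h < H) (s : S) :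
    M.value π h s = M.r h s (π.act h s) + ∫ x, M.value π (h + 1) x ∂(M.P h (s, π.act h s)) :=
  M.expReward_of_dirac hh (π.kernel_apply h s)

lemma qValue_eq_add {h : ℕ} (hh : h < H) (s : S) (a : A) :
    M.qValue π h s a = M.r h s a + ∫ x, M.value π (h + 1) x ∂(M.P h (s, a)) := by
  have htail : M.trajLaw (Function.update π.kernel h (Kernel.const S (Measure.dirac a)))
      (H - (h + 1)) (h + 1) = M.trajLaw π.kernel (H - (h + 1)) (h + 1) :=
    M.trajLaw_congr _ _ fun j hj => Function.update_of_ne (by omega) _ _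
  rw [qValue, M.expReward_of_dirac hh
    (by rw [Function.update_self, Kernel.const_apply] : _ = Measure.dirac a)]
  simp only [value, expReward, htail]

lemma value_eq_qValue {h : ℕ} (hh : h < H) (s : S) :
    M.value π h s = M.qValue π h s (π.act h s) := by
  rw [M.value_eq_add π hh, M.qValue_eq_add π hh]

lemma qValue_le_qStar (h : ℕ) (s : S) (a : A) : M.qValue π h s a ≤ M.qStar h s a := by
  refine le_ciSup (f := fun π => M.qValue π h s a) ⟨H, ?_⟩ π
  rintro _ ⟨π', rfl⟩
  exact (abs_le.1 (M.abs_expReward_le _ h s)).2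

variable {M π} in
lemma qValue_mono {π' : Policy S A} {h : ℕ} (hh : h < H)
    (hle : ∀ x, M.value π (h + 1) x ≤ M.value π' (h + 1) x) (s : S) (a : A) :
    M.qValue π h s a ≤ M.qValue π' h s a := by
  rw [M.qValue_eq_add π hh, M.qValue_eq_add π' hh]
  gcongr
  · exact M.integrable_value π _ _
  · exact M.integrable_value π' _ _
  · exact hle

end Values

/-- The optimal action-value function `Q^⋆`, as a candidate. -/
noncomputable def qStarFun : QFun S A H := fun h => M.qStar h

variable {M} {π : Policy S A} (hπ : IsGreedy M.qStarFun π)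
include hπ

lemma value_le_of_isGreedy_qStarFun (π' : Policy S A) (h : ℕ) (s : S) :
    M.value π' h s ≤ M.value π h s := by
  rcases le_or_gt H h with hh | hh
  · rw [M.value_of_le π' hh, M.value_of_le π hh]
  have : Nonempty (Policy S A) := ⟨π⟩
  calc M.value π' h s = M.qValue π' h s (π'.act h s) := M.value_eq_qValue π' hh s
    _ ≤ M.qStar h s (π'.act h s) := M.qValue_le_qStar π' h s _
    _ ≤ M.qStar h s (π.act h s) := hπ ⟨h, hh⟩ s _
    _ ≤ M.qValue π h s (π.act h s) := ciSup_le fun ρ =>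
        qValue_mono hh (fun x => value_le_of_isGreedy_qStarFun ρ (h + 1) x) s _
    _ = M.value π h s := (M.value_eq_qValue π hh s).symm
  termination_by H - h

lemma qStar_eq_qValue {h : ℕ} (hh : h < H) (s : S) (a : A) :
    M.qStar h s a = M.qValue π h s a := by
  have : Nonempty (Policy S A) := ⟨π⟩
  exact le_antisymm
    (ciSup_le fun ρ => qValue_mono hh (value_le_of_isGreedy_qStarFun hπ ρ (h + 1)) s a)
    (M.qValue_le_qStar π h s a)

lemma qStarFun_at_act (h : ℕ) (s : S) :
    M.qStarFun.at h s (π.act h s) = M.value π h s := by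
  rcases lt_or_ge h H with hh | hh
  · rw [QFun.at, dif_pos hh, M.value_eq_qValue π hh]
    exact qStar_eq_qValue hπ hh s _
  · rw [QFun.at, dif_neg hh.not_gt, M.value_of_le π hh]
    rfl

lemma valueStar_eq_value (h : ℕ) (s : S) : M.valueStar h s = M.value π h s := by
  have : Nonempty (Policy S A) := ⟨π⟩
  refine le_antisymm (ciSup_le fun ρ => value_le_of_isGreedy_qStarFun hπ ρ h s)
    (le_ciSup (f := fun ρ => M.value ρ h s) ⟨H, ?_⟩ π)
  rintro _ ⟨ρ, rfl⟩
  exact (abs_le.1 (M.abs_expReward_le _ h s)).2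

end MDP

/-! ### Bellman residuals -/

namespace QFun

omit [MeasurableSpace S] [MeasurableSpace A] in
lemma at_of_lt (f : QFun S A H) {h : ℕ} (hh : h < H) : f.at h = f ⟨h, hh⟩ := dif_pos hh

omit [MeasurableSpace S] [MeasurableSpace A] in
lemma at_of_le (f : QFun S A H) {h : ℕ} (hh : H ≤ h) : f.at h = 0 := dif_neg hh.not_gt

/-- A measurable candidate with values in `[0, 1]`. -/
def IsRegular (f : QFun S A H) : Prop :=
  ∀ h, Measurable (fun q : S × A => f h q.1 q.2) ∧ ∀ s a, f h s a ∈ Set.Icc (0 : ℝ) 1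

namespace IsRegular

variable {f : QFun S A H} (hf : f.IsRegular) (h : ℕ)
include hf

lemma measurable_at : Measurable (fun q : S × A => f.at h q.1 q.2) := by
  rcases lt_or_ge h H with hh | hh
  · simpa only [f.at_of_lt hh] using (hf ⟨h, hh⟩).1
  · simp only [f.at_of_le hh, Pi.zero_apply, measurable_const]

lemma at_mem_Icc (s : S) (a : A) : f.at h s a ∈ Set.Icc (0 : ℝ) 1 := by
  rcases lt_or_ge h H with hh | hh
  · simpa only [f.at_of_lt hh] using (hf ⟨h, hh⟩).2 s a
  · simp only [f.at_of_le hh, Pi.zero_apply, Set.left_mem_Icc, zero_le_one]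

lemma measurable_at_act (π : Policy S A) : Measurable (fun s => f.at h s (π.act h s)) :=
  (hf.measurable_at h).comp (measurable_id.prodMk (π.measurable_act h))

lemma integrable_at_act (π : Policy S A) (μ : Measure S) [IsFiniteMeasure μ] :
    Integrable (fun s => f.at h s (π.act h s)) μ :=
  .of_mem_Icc 0 1 (hf.measurable_at_act h π).aemeasurable
    (.of_forall fun s => hf.at_mem_Icc h s _)

lemma measurable_iSup_at [Countable A] : Measurable (fun s => ⨆ a, f.at h s a) :=
  .iSup fun _ => (hf.measurable_at h).comp measurable_prodMk_right

lemma iSup_at_mem_Icc [Nonempty A] (s : S) : ⨆ a, f.at h s a ∈ Set.Icc (0 : ℝ) 1 :=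
  ⟨Real.iSup_nonneg fun a => (hf.at_mem_Icc h s a).1, ciSup_le fun a => (hf.at_mem_Icc h s a).2⟩

lemma integrable_iSup_at [Countable A] [Nonempty A] (μ : Measure S) [IsFiniteMeasure μ] :
    Integrable (fun s => ⨆ a, f.at h s a) μ :=
  .of_mem_Icc 0 1 (hf.measurable_iSup_at h).aemeasurable
    (.of_forall fun s => hf.iSup_at_mem_Icc h s)

end IsRegular

end QFun

lemma IsGreedy.iSup_at_eq {f : QFun S A H} {π : Policy S A} (hg : IsGreedy f π) (h : ℕ) (s : S) :
    ⨆ a, f.at h s a = f.at h s (π.act h s) := by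
  have : Nonempty A := ⟨π.act h s⟩
  have hle : ∀ a, f.at h s a ≤ f.at h s (π.act h s) := fun a => by
    rcases lt_or_ge h H with hh | hh
    · simpa only [f.at_of_lt hh] using hg ⟨h, hh⟩ s a
    · simp only [f.at_of_le hh, Pi.zero_apply, le_refl]
  exact le_antisymm (ciSup_le hle)
    (le_ciSup (f := f.at h s) ⟨_, Set.forall_mem_range.2 hle⟩ (π.act h s))

namespace MDP

variable (M : MDP S A H) (gr : QFun S A H → Policy S A)

lemma vResidual_qStarFun (hg : IsGreedy M.qStarFun (gr M.qStarFun)) (h : Fin H) (s : S) :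
    M.vResidual gr M.qStarFun h s = 0 := by
  simp only [vResidual, bellman, hg.iSup_at_eq, qStarFun_at_act hg, ← M.value_eq_add _ h.2]
  rw [← M.qStarFun.at_of_lt h.2, qStarFun_at_act hg, sub_self]

section TemporalDifference

variable [Countable A] {f : QFun S A H} (hf : f.IsRegular) (h : Fin H)
include hf

lemma measurable_tdError : Measurable (M.tdError f h) :=
  (((hf h).1.comp (g := fun q : S × A => f h q.1 q.2) (f := fun z : Tuple S A => (z.1, z.2.1))
    (by fun_prop)).sub (M.measurable_r_tuple h)).sub
    ((hf.measurable_iSup_at (h + 1)).comp (f := fun z : Tuple S A => z.2.2) (by fun_prop))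

variable [Nonempty A]

omit [Countable A] in
lemma abs_tdError_le (z : Tuple S A) : |M.tdError f h z| ≤ 2 := by
  obtain ⟨hf_nonneg, hf_le⟩ := (hf h).2 z.1 z.2.1
  obtain ⟨hsup_nonneg, hsup_le⟩ := hf.iSup_at_mem_Icc (h + 1) z.2.2
  have hr_le := (abs_le.1 (M.abs_r_le_one h.2 z.1 z.2.1)).2
  have hr_nonneg := M.r_nonneg h z.1 z.2.1
  unfold tdError
  exact abs_le.2 ⟨by linarith, by linarith⟩

lemma integrable_tdError (μ : Measure (Tuple S A)) [IsFiniteMeasure μ] :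
    Integrable (M.tdError f h) μ :=
  .of_bound (M.measurable_tdError hf h).aestronglyMeasurable 2
    (.of_forall (M.abs_tdError_le hf h))

lemma integral_tdError (s : S) :
    ∫ s', M.tdError f h (s, (gr f).act h s, s') ∂(M.P h (s, (gr f).act h s)) =
      M.vResidual gr f h s := by
  simp only [tdError, vResidual, bellman]
  rw [integral_sub (integrable_const _) (hf.integrable_iSup_at (h + 1) _), integral_const,
    probReal_univ, one_smul, sub_sub]

lemma integral_tdError_stepLaw (s : S) :
    ∫ z, M.tdError f h z ∂(M.stepLaw (gr f).kernel h s) = M.vResidual gr f h s := by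
  rw [M.stepLaw_apply_of_dirac ((gr f).kernel_apply h s), integral_map (by fun_prop)
    (M.measurable_tdError hf h).aestronglyMeasurable, M.integral_tdError gr hf]

lemma integrable_vResidual (μ : Measure S) [IsFiniteMeasure μ] :
    Integrable (M.vResidual gr f h) μ := by
  rw [← funext (M.integral_tdError_stepLaw gr hf h)]
  exact .of_bound
    (M.measurable_tdError hf h).stronglyMeasurable.integral_kernel.aestronglyMeasurable 2
    (.of_forall fun s => abs_integral_le_of_abs_le (.of_forall (M.abs_tdError_le hf h)))

end TemporalDifference

/-- The expected V-type Bellman residual of `f` at step `h` under the roll-in policy `π`. -/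
noncomputable def meanResidual (π : Policy S A) (f : QFun S A H) (h : Fin H) : ℝ :=
  ∫ s, M.vResidual gr f h s ∂((M.episodeLaw π.kernel).map fun τ => (τ h).1)

lemma meanResidual_eq_integral_stateLaw (π : Policy S A) (f : QFun S A H) (h : Fin H) :
    M.meanResidual gr π f h = ∫ s, M.vResidual gr f h s ∂(M.stateLaw π.kernel h 0 M.init) := by
  rw [meanResidual, map_episodeLaw_state]

lemma meanResidual_qStarFun (hg : IsGreedy M.qStarFun (gr M.qStarFun)) (π : Policy S A)
    (h : Fin H) : M.meanResidual gr π M.qStarFun h = 0 := by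
  simp only [meanResidual, M.vResidual_qStarFun gr hg, integral_zero]

section PolicyLoss

/-- The amount by which the candidate `f` overestimates, at step `h`, the value of its own greedy
policy. -/
noncomputable def valueGap (f : QFun S A H) (h : ℕ) (s : S) : ℝ :=
  f.at h s ((gr f).act h s) - M.value (gr f) h s

variable {gr} {f : QFun S A H} (hf : f.IsRegular)
include hf

lemma measurable_valueGap (h : ℕ) : Measurable (M.valueGap gr f h) :=
  (hf.measurable_at_act h (gr f)).sub (M.measurable_expReward _ h)

lemma integrable_valueGap (h : ℕ) (μ : Measure S) [IsFiniteMeasure μ] :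
    Integrable (M.valueGap gr f h) μ :=
  (hf.integrable_at_act h (gr f) μ).sub (M.integrable_value (gr f) h μ)

variable (hg : IsGreedy f (gr f))
include hg

lemma valueGap_eq_add (h : Fin H) (s : S) : M.valueGap gr f h s =
    M.vResidual gr f h s +
      ∫ x, M.valueGap gr f (h + 1) x ∂(M.transKernel (gr f).kernel h s) := by
  simp only [valueGap, vResidual, bellman, hg.iSup_at_eq]
  rw [M.transKernel_apply_of_dirac ((gr f).kernel_apply h s),
    integral_sub (hf.integrable_at_act _ _ _) (M.integrable_value _ _ _),
    M.value_eq_add (gr f) h.2, f.at_of_lt h.2]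
  ring

lemma integral_valueGap_sub_integral_valueGap_succ [Countable A] [Nonempty A] (h : Fin H) :
    ∫ s, M.valueGap gr f h s ∂(M.stateLaw (gr f).kernel h 0 M.init) -
        ∫ s, M.valueGap gr f (h + 1) s ∂(M.stateLaw (gr f).kernel (h + 1) 0 M.init) =
      M.meanResidual gr (gr f) f h := by
  have hint := M.integrable_valueGap (gr := gr) hf (h + 1)
    ((M.transKernel (gr f).kernel h ∘ₖ M.stateLaw (gr f).kernel h 0) M.init)
  rw [meanResidual_eq_integral_stateLaw, stateLaw_succ_last, zero_add,
    Kernel.integral_comp hint]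
  simp only [M.valueGap_eq_add hf hg h]
  rw [integral_add (M.integrable_vResidual gr hf h _) hint.integral_comp, add_sub_cancel_right]

lemma sum_meanResidual [Countable A] [Nonempty A] :
    ∑ h, M.meanResidual gr (gr f) f h = M.valueGap gr f 0 M.init := by
  simp only [← M.integral_valueGap_sub_integral_valueGap_succ hf hg]
  rw [← Finset.sum_range fun h => ∫ s, M.valueGap gr f h s ∂(M.stateLaw (gr f).kernel h 0 M.init) -
    ∫ s, M.valueGap gr f (h + 1) s ∂(M.stateLaw (gr f).kernel (h + 1) 0 M.init),
    Finset.sum_range_sub']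
  rw [stateLaw, Kernel.id_apply,
    integral_dirac' _ _ (M.measurable_valueGap hf 0).stronglyMeasurable]
  simp only [valueGap, f.at_of_le le_rfl, M.value_of_le (gr f) le_rfl, Pi.zero_apply, sub_self,
    integral_zero, sub_zero]

lemma isOptimalUpTo_of_sum_meanResidual_le [Countable A] [Nonempty A] {ε : ℝ}
    (hgStar : IsGreedy M.qStarFun (gr M.qStarFun))
    (hopt : M.qStarFun.at 0 M.init ((gr M.qStarFun).act 0 M.init) ≤
      f.at 0 M.init ((gr f).act 0 M.init))
    (hsum : ∑ h, M.meanResidual gr (gr f) f h ≤ ε) : M.IsOptimalUpTo ε (gr f) := by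
  rw [M.sum_meanResidual hf hg, valueGap] at hsum
  rw [qStarFun_at_act hgStar, ← valueStar_eq_value hgStar] at hopt
  unfold IsOptimalUpTo
  linarith

end PolicyLoss

end MDP

/-! ### Accuracy of the estimates -/

namespace MDP

section Activation

variable (M : MDP S A H) (gr : QFun S A H → Policy S A)

/-- The activation estimates of `f` at all steps are within `η` of the mean residuals. -/
def ActAccurate (f : QFun S A H) (η : ℝ) {n : ℕ} (D : Data S A H n) : Prop :=
  ∀ h, |M.actEstimate f h D - M.meanResidual gr (gr f) f h| ≤ η

variable [Countable A] {f : QFun S A H} (hf : f.IsRegular)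
include hf

lemma measurable_actEstimate (h : Fin H) (n : ℕ) :
    Measurable fun D : Data S A H n => M.actEstimate f h D :=
  (Finset.measurable_fun_sum _ fun i _ => (M.measurable_tdError hf h).comp
    (f := fun D : Data S A H n => D i h) (by fun_prop)).const_mul _

variable [Nonempty A]

lemma integral_tdError_episodeLaw (h : Fin H) :
    ∫ τ, M.tdError f h (τ h) ∂(M.episodeLaw (gr f).kernel) = M.meanResidual gr (gr f) f h := by
  have : IsProbabilityMeasure ((M.episodeLaw (gr f).kernel).map fun τ => τ h) :=
    Measure.isProbabilityMeasure_map (measurable_pi_apply h).aemeasurable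
  rw [M.integral_episodeLaw_eval _ h (M.integrable_tdError hf h _),
    meanResidual_eq_integral_stateLaw]
  simp only [M.integral_tdError_stepLaw gr hf]

lemma dataLaw_not_actAccurate_le (n : ℕ) {η : ℝ} (hη : 0 ≤ η) (hη1 : η ≤ 1) :
    M.dataLaw (gr f).kernel n {D | ¬ M.ActAccurate gr f η D} ≤
      ENNReal.ofReal (H * (2 * Real.exp (-(n * η ^ 2 / 16)))) := by
  have hstep (h : Fin H) : M.dataLaw (gr f).kernel n
      {D | η < |M.actEstimate f h D - M.meanResidual gr (gr f) f h|} ≤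
        ENNReal.ofReal (2 * Real.exp (-(n * η ^ 2 / 16))) := by
    have hsq : ∫ τ, M.tdError f h (τ h) ^ 2 ∂(M.episodeLaw (gr f).kernel) ≤ 4 := by
      refine (le_abs_self _).trans (abs_integral_le_of_abs_le (.of_forall fun τ => ?_))
      rw [abs_pow]
      exact (pow_le_pow_left₀ (abs_nonneg _) (M.abs_tdError_le hf h _) 2).trans_eq (by norm_num)
    have hmeas : Measurable fun τ : Episode S A H => M.tdError f h (τ h) :=
      (M.measurable_tdError hf h).comp (measurable_pi_apply h)
    have hdev := measure_lt_abs_empiricalMean_sub_integral_le (n := n) (b := 2) hmeas.aemeasurable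
      (.of_forall fun τ => M.abs_tdError_le hf h (τ h)) hsq (by norm_num) hη (by linarith)
    rw [M.integral_tdError_episodeLaw gr hf, show (4 : ℝ) * 4 = 16 by norm_num] at hdev
    exact hdev
  have hunion := measure_exists_mem_le_ofReal (s := Finset.univ) fun h _ => hstep h
  simpa only [ActAccurate, not_forall, not_le, Finset.mem_univ, true_and, Finset.card_fin]
    using hunion

end Activation

end MDP

section ActionWeight

variable [Fintype A] (π : Policy S A) (t : ℕ)

open Classical in
/-- The importance weight `|A| 1[a = π_t(s)]` of the action that `π` prescribes at step `t`, when
the action has been drawn uniformly; it is written as a quotient by `1 / |A|` to match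
`MDP.elimEstimate`. -/
noncomputable def actionWeight (z : Tuple S A) : ℝ :=
  (if z.2.1 = π.act t z.1 then 1 else 0) / (1 / (Fintype.card A : ℝ))

lemma actionWeight_nonneg (z : Tuple S A) : 0 ≤ actionWeight π t z := by
  unfold actionWeight
  positivity

lemma actionWeight_le_card (z : Tuple S A) : actionWeight π t z ≤ Fintype.card A := by
  unfold actionWeight
  split_ifs
  · rw [one_div_one_div]
  · rw [zero_div]
    exact Nat.cast_nonneg _

lemma abs_actionWeight_mul_le {b c : ℝ} {z : Tuple S A} (hc : |c| ≤ b) :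
    |actionWeight π t z * c| ≤ Fintype.card A * b := by
  rw [abs_mul, abs_of_nonneg (actionWeight_nonneg π t z)]
  exact mul_le_mul (actionWeight_le_card π t z) hc (abs_nonneg c) (Nat.cast_nonneg _)

variable [MeasurableSingletonClass A]

lemma measurable_actionWeight : Measurable (actionWeight π t) :=
  (Measurable.ite (measurableSet_eq_fun (by fun_prop) ((π.measurable_act t).comp measurable_fst))
    measurable_const measurable_const).div_const _

lemma integrable_actionWeight_mul {φ : Tuple S A → ℝ} {b : ℝ} (hφ : Measurable φ)
    (hb : ∀ z, |φ z| ≤ b) (μ : Measure (Tuple S A)) [IsFiniteMeasure μ] :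
    Integrable (fun z => actionWeight π t z * φ z) μ :=
  .of_bound ((measurable_actionWeight π t).mul hφ).aestronglyMeasurable (Fintype.card A * b)
    (.of_forall fun z => abs_actionWeight_mul_le π t (hb z))

end ActionWeight

namespace MDP

variable [Fintype A] [Nonempty A] [MeasurableSingletonClass A] (M : MDP S A H)

instance (π : Policy S A) (t h : ℕ) : IsMarkovKernel (explore π t h) := by
  unfold explore
  infer_instance

section ImportanceWeighting

variable (π π' : Policy S A) {φ : Tuple S A → ℝ} {b : ℝ} (hφ : Measurable φ)
  (hb : ∀ z, |φ z| ≤ b)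
include hφ hb

lemma integral_actionWeight_mul_stepLaw (t : ℕ) (s : S) :
    ∫ z, actionWeight π' t z * φ z ∂(M.stepLaw (explore π t) t s) =
      ∫ s', φ (s, π'.act t s, s') ∂(M.P t (s, π'.act t s)) := by
  rw [M.integral_stepLaw _ t s (integrable_actionWeight_mul π' t hφ hb _)]
  simp only [explore, Function.update_self, Kernel.const_apply]
  rw [PMF.integral_eq_sum, Finset.sum_eq_single (π'.act t s)]
  · have hcard : (Fintype.card A : ℝ) ≠ 0 := Nat.cast_ne_zero.2 Fintype.card_ne_zero
    simp only [actionWeight, if_true, PMF.uniformOfFintype_apply, integral_const_mul, smul_eq_mul,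
      ENNReal.toReal_inv, ENNReal.toReal_natCast]
    field_simp
  · intro a _ ha
    simp only [actionWeight, ha, if_false, zero_div, zero_mul, integral_zero, smul_zero]
  · exact fun hmem => absurd (Finset.mem_univ _) hmem

lemma integral_actionWeight_mul_episodeLaw (t : Fin H) :
    ∫ τ, actionWeight π' t (τ t) * φ (τ t) ∂(M.episodeLaw (explore π t)) =
      ∫ s, ∫ s', φ (s, π'.act t s, s') ∂(M.P t (s, π'.act t s))
        ∂(M.stateLaw π.kernel t 0 M.init) := by
  have : IsProbabilityMeasure ((M.episodeLaw (explore π t)).map fun τ => τ t) :=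
    Measure.isProbabilityMeasure_map (measurable_pi_apply t).aemeasurable
  rw [M.integral_episodeLaw_eval _ t (integrable_actionWeight_mul π' t hφ hb _),
    M.stateLaw_congr (κ := explore π t) t 0 fun j _ hj => Function.update_of_ne (by omega) _ _]
  simp only [M.integral_actionWeight_mul_stepLaw π π' hφ hb]

end ImportanceWeighting

section Moments

variable (gr : QFun S A H → Policy S A) (π : Policy S A) {f : QFun S A H} (hf : f.IsRegular)
  (t : Fin H)

lemma integral_actionWeight_episodeLaw :
    ∫ τ, actionWeight (gr f) t (τ t) ∂(M.episodeLaw (explore π t)) = 1 := by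
  have hone := M.integral_actionWeight_mul_episodeLaw π (gr f) (φ := fun _ => 1) (b := 1)
    measurable_const (fun _ => abs_one.le) t
  simpa only [mul_one, integral_const, probReal_univ, one_smul] using hone

include hf

lemma integral_actionWeight_mul_tdError :
    ∫ τ, actionWeight (gr f) t (τ t) * M.tdError f t (τ t) ∂(M.episodeLaw (explore π t)) =
      M.meanResidual gr π f t := by
  rw [M.integral_actionWeight_mul_episodeLaw π (gr f) (M.measurable_tdError hf t)
    (M.abs_tdError_le hf t), meanResidual_eq_integral_stateLaw]
  simp only [M.integral_tdError gr hf]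

lemma integral_actionWeight_mul_tdError_sq_le :
    ∫ τ, (actionWeight (gr f) t (τ t) * M.tdError f t (τ t)) ^ 2 ∂(M.episodeLaw (explore π t)) ≤
      4 * Fintype.card A := by
  have hint : Integrable (fun τ : Episode S A H => actionWeight (gr f) t (τ t))
      (M.episodeLaw (explore π t)) :=
    .of_mem_Icc 0 (Fintype.card A)
      ((measurable_actionWeight (gr f) t).comp (measurable_pi_apply t)).aemeasurable
      (.of_forall fun τ => ⟨actionWeight_nonneg _ _ _, actionWeight_le_card _ _ _⟩)
  have hpoint (z : Tuple S A) : (actionWeight (gr f) t z * M.tdError f t z) ^ 2 ≤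
      4 * Fintype.card A * actionWeight (gr f) t z := by
    have hw := actionWeight_nonneg (gr f) t z
    have htd := sq_le_sq.2 ((M.abs_tdError_le hf t z).trans (le_abs_self 2))
    calc (actionWeight (gr f) t z * M.tdError f t z) ^ 2
        = actionWeight (gr f) t z * actionWeight (gr f) t z * M.tdError f t z ^ 2 := by ring
      _ ≤ Fintype.card A * actionWeight (gr f) t z * 2 ^ 2 := by
        gcongr ?_ * _ * ?_
        exact actionWeight_le_card _ _ _
      _ = 4 * Fintype.card A * actionWeight (gr f) t z := by ring
  calc ∫ τ, (actionWeight (gr f) t (τ t) * M.tdError f t (τ t)) ^ 2 ∂(M.episodeLaw (explore π t))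
      ≤ ∫ τ, 4 * Fintype.card A * actionWeight (gr f) t (τ t) ∂(M.episodeLaw (explore π t)) :=
        integral_mono_of_nonneg (.of_forall fun _ => sq_nonneg _) (hint.const_mul _)
          (.of_forall fun τ => hpoint (τ t))
    _ = 4 * Fintype.card A := by
        rw [integral_const_mul, M.integral_actionWeight_episodeLaw, mul_one]

end Moments

section Elimination

variable (gr : QFun S A H → Policy S A) (t : Fin H)

omit [Nonempty A] in
lemma measurable_elimEstimate {f : QFun S A H} (hf : f.IsRegular) (n : ℕ) :
    Measurable fun D : Data S A H n => M.elimEstimate gr f t D :=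
  (Finset.measurable_fun_sum _ fun i _ =>
    ((measurable_actionWeight (gr f) t).mul (M.measurable_tdError hf t)).comp
      (f := fun D : Data S A H n => D i t) (by fun_prop)).const_mul _

variable (π : Policy S A) (F : Set (QFun S A H))

omit [Nonempty A] [MeasurableSingletonClass A] in
/-- The elimination estimates at step `t` of all candidates in `F` are within `η` of the mean
residuals under the roll-in policy `π`. -/
def ElimAccurate (η : ℝ) {n : ℕ} (D : Data S A H n) : Prop :=
  ∀ g ∈ F, |M.elimEstimate gr g t D - M.meanResidual gr π g t| ≤ η

variable {F}

lemma dataLaw_not_elimAccurate_le (hF : F.Finite) (hreg : ∀ f ∈ F, f.IsRegular) (n : ℕ) {η : ℝ}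
    (hη : 0 ≤ η) (hη1 : η ≤ 1) :
    M.dataLaw (explore π t) n {D | ¬ M.ElimAccurate gr t π F η D} ≤
      ENNReal.ofReal (F.ncard * (2 * Real.exp (-(n * η ^ 2 / (16 * Fintype.card A))))) := by
  have hcard : (0 : ℝ) < Fintype.card A := Nat.cast_pos.2 Fintype.card_pos
  have hcandidate (f : QFun S A H) (hf : f.IsRegular) : M.dataLaw (explore π t) n
      {D | η < |M.elimEstimate gr f t D - M.meanResidual gr π f t|} ≤
        ENNReal.ofReal (2 * Real.exp (-(n * η ^ 2 / (16 * Fintype.card A)))) := by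
    have hmeas : Measurable fun τ : Episode S A H =>
        actionWeight (gr f) t (τ t) * M.tdError f t (τ t) :=
      ((measurable_actionWeight (gr f) t).mul (M.measurable_tdError hf t)).comp
        (measurable_pi_apply t)
    have hdev := measure_lt_abs_empiricalMean_sub_integral_le (n := n) (b := Fintype.card A * 2)
      hmeas.aemeasurable
      (.of_forall fun τ => abs_actionWeight_mul_le _ _ (M.abs_tdError_le hf t (τ t)))
      (M.integral_actionWeight_mul_tdError_sq_le gr π hf t) (by positivity) hη (by nlinarith)
    rw [M.integral_actionWeight_mul_tdError gr π hf, ← mul_assoc,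
      show (4 : ℝ) * 4 = 16 by norm_num] at hdev
    exact hdev
  have hunion := measure_exists_mem_le_ofReal (s := hF.toFinset) fun f hf =>
    hcandidate f (hreg f (hF.mem_toFinset.1 hf))
  simpa only [ElimAccurate, not_forall, not_le, exists_prop, hF.mem_toFinset,
    ← Set.ncard_eq_toFinset_card F hF] using hunion

end Elimination

end MDP

/-! ### Runs of OLIVE -/

section EluderSequence

variable {X : Type*} [MeasurableSpace X] {G : Set (X → ℝ)} {Pi : Set (Measure X)} {ε : ℝ} {n : ℕ}
  {ρ : ℕ → Measure X}

/-- The measures `ρ 0, …, ρ (n - 1)` are a sequence as in the definition of the distributional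
Eluder dimension, at the scale `ε`; the later values of `ρ` play no role. -/
def IsEluderSequence (G : Set (X → ℝ)) (Pi : Set (Measure X)) (ε : ℝ) (n : ℕ)
    (ρ : ℕ → Measure X) : Prop :=
  ∀ i < n, ρ i ∈ Pi ∧ EpsIndependent G ε (fun j : Fin i => ρ j) (ρ i)

lemma IsEluderSequence.le_deDim (hρ : IsEluderSequence G Pi ε n ρ) : (n : ℕ∞) ≤ deDim G Pi ε :=
  le_iSup₂_of_le n ⟨ρ, fun i hi => (hρ i hi).1, ε, le_rfl, fun i hi => (hρ i hi).2⟩ le_rfl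

lemma IsEluderSequence.update (hρ : IsEluderSequence G Pi ε n ρ) {ν : Measure X} (hν : ν ∈ Pi)
    (hind : EpsIndependent G ε (fun j : Fin n => ρ j) ν) :
    IsEluderSequence G Pi ε (n + 1) (Function.update ρ n ν) := by
  have hprefix {i : ℕ} (hi : i ≤ n) :
      (fun j : Fin i => Function.update ρ n ν j) = fun j : Fin i => ρ j :=
    funext fun j => Function.update_of_ne (by omega) _ _
  refine Nat.forall_lt_succ_right.2 ⟨fun i hi => ?_, ?_⟩
  · rw [hprefix hi.le, Function.update_of_ne hi.ne]
    exact hρ i hi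
  · rw [hprefix le_rfl, Function.update_self]
    exact ⟨hν, hind⟩

end EluderSequence

namespace MDP

section History

variable (M : MDP S A H) (gr : QFun S A H → Policy S A)

/-- At step `h` there is an Eluder sequence of `n` roll-in laws, at the scale `ε`, under which all
candidates of the version space `B` have mean residuals of size at most `η`. -/
def HasHistory (F B : Set (QFun S A H)) (ε η : ℝ) (h : Fin H) (n : ℕ) : Prop :=
  ∃ ρ : ℕ → Measure S, IsEluderSequence (M.vResidualClass gr F h) (M.rollIn gr F h) ε n ρ ∧
    ∀ g ∈ B, ∀ i < n, |∫ s, M.vResidual gr g h s ∂(ρ i)| ≤ η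

variable {M gr} {F B B' : Set (QFun S A H)} {ε η : ℝ} {h : Fin H} {n d : ℕ}

lemma hasHistory_zero : M.HasHistory gr F B ε η h 0 :=
  ⟨fun _ => 0, fun _ hi => absurd hi (Nat.not_lt_zero _),
    fun _ _ _ hi => absurd hi (Nat.not_lt_zero _)⟩

namespace HasHistory

variable (hhist : M.HasHistory gr F B ε η h n)
include hhist

lemma le_of_vbeDim_le (hd : M.vbeDim gr F ε ≤ d) : n ≤ d := by
  obtain ⟨ρ, hρ, -⟩ := hhist
  exact Nat.cast_le.1 ((hρ.le_deDim.trans (le_iSup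
    (fun h => deDim (M.vResidualClass gr F h) (M.rollIn gr F h) ε) h)).trans hd)

lemma mono (hB : B' ⊆ B) : M.HasHistory gr F B' ε η h n := by
  obtain ⟨ρ, hρ, hsmall⟩ := hhist
  exact ⟨ρ, hρ, fun g hg => hsmall g (hB hg)⟩

lemma succ (hd : M.vbeDim gr F ε ≤ d) (hε : Real.sqrt d * η ≤ ε) (hη : 0 ≤ η) (hB : B' ⊆ B)
    {f : QFun S A H} (hfB : f ∈ B) (hfF : f ∈ F) (hlarge : ε < M.meanResidual gr (gr f) f h)
    (hsmall' : ∀ g ∈ B', |M.meanResidual gr (gr f) g h| ≤ η) :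
    M.HasHistory gr F B' ε η h (n + 1) := by
  have hnd := hhist.le_of_vbeDim_le hd
  obtain ⟨ρ, hρ, hsmall⟩ := hhist
  have hsum : ∑ i : Fin n, (∫ s, M.vResidual gr f h s ∂(ρ i)) ^ 2 ≤ (Real.sqrt d * η) ^ 2 := by
    calc ∑ i : Fin n, (∫ s, M.vResidual gr f h s ∂(ρ i)) ^ 2 ≤ ∑ _i : Fin n, η ^ 2 :=
          Finset.sum_le_sum fun i _ => sq_le_sq.2 ((hsmall f hfB i i.2).trans (le_abs_self η))
      _ = n * η ^ 2 := by rw [Finset.sum_const, Finset.card_fin, nsmul_eq_mul]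
      _ ≤ d * η ^ 2 := by gcongr
      _ = (Real.sqrt d * η) ^ 2 := by rw [mul_pow, Real.sq_sqrt (Nat.cast_nonneg d)]
  refine ⟨_, hρ.update ⟨f, hfF, rfl⟩ ⟨_, ⟨f, hfF, rfl⟩, ?_, hlarge.trans_le (le_abs_self _)⟩,
    fun g hg => Nat.forall_lt_succ_right.2 ⟨fun i hi => ?_, ?_⟩⟩
  · exact (Real.sqrt_le_left (by positivity)).2 hsum |>.trans hε
  · rw [Function.update_of_ne hi.ne]
    exact hsmall g (hB hg) i hi
  · rw [Function.update_self]
    exact hsmall' g hg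

end HasHistory

end History

/-- The standing assumptions on the candidates: they are regular, `gr` selects greedy policies, and
the optimal action-value function is among them. -/
structure IsRealizableClass (M : MDP S A H) (gr : QFun S A H → Policy S A)
    (F : Set (QFun S A H)) : Prop where
  regular : ∀ f ∈ F, f.IsRegular
  greedy : ∀ f ∈ F, IsGreedy f (gr f)
  qStarFun_mem : M.qStarFun ∈ F

lemma isOptimalUpTo_of_actAccurate [Countable A] [Nonempty A] {M : MDP S A H}
    {gr : QFun S A H → Policy S A} {F : Set (QFun S A H)} {f : QFun S A H} {ε : ℝ} {n : ℕ}
    {D : Data S A H n} (hF : M.IsRealizableClass gr F) (hf : f ∈ F)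
    (hopt : M.qStarFun.at 0 M.init ((gr M.qStarFun).act 0 M.init) ≤
      f.at 0 M.init ((gr f).act 0 M.init))
    (hacc : M.ActAccurate gr f ε D) (hterm : ∑ h, M.actEstimate f h D ≤ H * (2 * ε)) :
    M.IsOptimalUpTo (3 * (H * ε)) (gr f) := by
  refine M.isOptimalUpTo_of_sum_meanResidual_le (hF.regular f hf) (hF.greedy f hf)
    (hF.greedy _ hF.qStarFun_mem) hopt ?_
  calc ∑ h, M.meanResidual gr (gr f) f h ≤ ∑ h, (M.actEstimate f h D + ε) :=
        Finset.sum_le_sum fun h _ => by linarith [(abs_le.1 (hacc h)).1]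
    _ = ∑ h, M.actEstimate f h D + H * ε := by
        rw [Finset.sum_add_distrib, Finset.sum_const, Finset.card_fin, nsmul_eq_mul]
    _ ≤ 3 * (H * ε) := by linarith

/-- The invariant of a run: the version space `B` still contains `Q^⋆`, and `n h` of the previous
phases have eliminated at step `h`. -/
structure IsVersionSpace (M : MDP S A H) (gr : QFun S A H → Policy S A) (F : Set (QFun S A H))
    (ε η : ℝ) (B : Set (QFun S A H)) (n : Fin H → ℕ) : Prop where
  subset : B ⊆ F
  qStarFun_mem : M.qStarFun ∈ B
  hasHistory : ∀ h, M.HasHistory gr F B ε η h (n h)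

lemma oliveProb_mono [Fintype A] [Nonempty A] (M : MDP S A H) {gr : QFun S A H → Policy S A}
    {F : Set (QFun S A H)} {p : Params} {ch : Choices S A H p.nAct} {E E' : Policy S A → ℕ → Prop}
    (hE : ∀ π n, E π n → E' π n) : M.oliveProb gr F p ch E ≤ M.oliveProb gr F p ch E' :=
  iSup_mono fun _ => measure_mono fun _ ⟨π, n, ho, h⟩ => ⟨π, n, ho, hE π n h⟩

section Run

variable {M : MDP S A H} {gr : QFun S A H → Policy S A} {F B : Set (QFun S A H)} {ε : ℝ} {d : ℕ}

namespace IsVersionSpace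

variable {η : ℝ} {n : Fin H → ℕ}

lemma sum_le (hB : M.IsVersionSpace gr F ε η B n) (hd : M.vbeDim gr F ε ≤ d) :
    ∑ h, n h ≤ H * d := by
  refine (Finset.sum_le_card_nsmul _ _ d fun h _ =>
    (hB.hasHistory h).le_of_vbeDim_le hd).trans_eq ?_
  rw [Finset.card_fin, smul_eq_mul]

lemma eliminate [Fintype A] {ζ : ℝ} (hF : M.IsRealizableClass gr F)
    (hB : M.IsVersionSpace gr F ε (2 * ζ) B n) (hd : M.vbeDim gr F ε ≤ d)
    (hε : Real.sqrt d * (2 * ζ) ≤ ε) {f : QFun S A H} (hf : f ∈ B) {t : Fin H}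
    (hlarge : ε < M.meanResidual gr (gr f) f t) {N : ℕ} {D : Data S A H N}
    (hacc : M.ElimAccurate gr t (gr f) F ζ D) :
    M.IsVersionSpace gr F ε (2 * ζ) {g ∈ B | |M.elimEstimate gr g t D| ≤ ζ}
      (Function.update n t (n t + 1)) := by
  have hsub : {g ∈ B | |M.elimEstimate gr g t D| ≤ ζ} ⊆ B := Set.sep_subset _ _
  have hqStar := hacc _ hF.qStarFun_mem
  have hζ : 0 ≤ ζ := (abs_nonneg _).trans hqStar
  rw [M.meanResidual_qStarFun gr (hF.greedy _ hF.qStarFun_mem), sub_zero] at hqStar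
  refine ⟨hsub.trans hB.subset, ⟨hB.qStarFun_mem, hqStar⟩, fun h => ?_⟩
  rcases eq_or_ne h t with rfl | hne
  · rw [Function.update_self]
    refine (hB.hasHistory h).succ hd hε (by positivity) hsub hf (hB.subset hf) hlarge fun g hg => ?_
    obtain ⟨hlow, hup⟩ := abs_le.1 (hacc g (hB.subset hg.1))
    obtain ⟨hlow', hup'⟩ := abs_le.1 hg.2
    exact abs_le.2 ⟨by linarith, by linarith⟩
  · rw [Function.update_of_ne hne]
    exact (hB.hasHistory h).mono hsub

end IsVersionSpace

variable [Fintype A] [Nonempty A] [MeasurableSingletonClass A] {p : Params}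
  {ch : Choices S A H p.nAct} (hfin : F.Finite) (hF : M.IsRealizableClass gr F)
  (hch : ch.Valid M gr F p)
include hfin hF hch

lemma oliveLaw_succ_apply (hB : B ⊆ F) (hne : B.Nonempty) (N k m : ℕ) (E : Set (Outcome S A)) :
    M.oliveLaw gr p ch (N + 1) k B m E =
      ∫⁻ D, if ∑ h, M.actEstimate (ch.optimist k B) h D ≤ H * p.zetaAct then
          Measure.dirac (Outcome.done (gr (ch.optimist k B)) (m + p.nAct)) E
        else ∫⁻ D', M.oliveLaw gr p ch N (k + 1)
            {g ∈ B | |M.elimEstimate gr g (ch.pick k B D) D'| ≤ p.zetaElim}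
            (m + p.nAct + p.nElim) E
          ∂(M.dataLaw (explore (gr (ch.optimist k B)) (ch.pick k B D)) p.nElim)
        ∂(M.dataLaw (gr (ch.optimist k B)).kernel p.nAct) := by
  set f := ch.optimist k B
  have hf : f.IsRegular := hF.regular f (hB (hch.optimist_mem k B hB hne))
  let next (t : Fin H) (D' : Data S A H p.nElim) : Measure (Outcome S A) :=
    M.oliveLaw gr p ch N (k + 1) {g ∈ B | |M.elimEstimate gr g t D'| ≤ p.zetaElim}
      (m + p.nAct + p.nElim)
  have hnext (t : Fin H) : Measurable (next t) :=
    measurable_comp_sep (hfin.subset hB)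
      (fun g hg => measurableSet_le
        (M.measurable_elimEstimate gr t (hF.regular g (hB hg)) p.nElim).abs measurable_const)
      (fun B' => M.oliveLaw gr p ch N (k + 1) B' (m + p.nAct + p.nElim))
  have hcont : Measurable fun D => (M.dataLaw (explore (gr f) (ch.pick k B D)) p.nElim).bind
      (next (ch.pick k B D)) :=
    (Measurable.of_discrete (f := fun t : Fin H =>
      (M.dataLaw (explore (gr f) t) p.nElim).bind (next t))).comp (hch.measurable_pick k B hB hne)
  have hterm : MeasurableSet {D : Data S A H p.nAct |
      ∑ h, M.actEstimate f h D ≤ H * p.zetaAct} :=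
    measurableSet_le (Finset.measurable_fun_sum _ fun h _ => M.measurable_actEstimate hf h _)
      measurable_const
  have hE : MeasurableSet E := trivial
  refine (Measure.bind_apply hE
    (Measurable.ite hterm measurable_const hcont).aemeasurable).trans
    (lintegral_congr fun D => ?_)
  split_ifs
  · rfl
  · exact Measure.bind_apply hE (hnext _).aemeasurable

section Confidence

variable {yAct yElim : ℝ} (hyAct : 0 ≤ yAct) (hyElim : 0 ≤ yElim) (hzeta : p.zetaAct = 2 * ε)
  (hact : ∀ f ∈ F, M.dataLaw (gr f).kernel p.nAct {D | ¬ M.ActAccurate gr f ε D} ≤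
    ENNReal.ofReal yAct)
  (helim : ∀ f ∈ F, ∀ t : Fin H, M.dataLaw (explore (gr f) t) p.nElim
    {D | ¬ M.ElimAccurate gr t (gr f) F p.zetaElim D} ≤ ENNReal.ofReal yElim)
include hyAct hyElim hzeta hact helim

lemma le_oliveLaw_succ (hB : B ⊆ F) (hqStar : M.qStarFun ∈ B) {N k m : ℕ}
    {E : Set (Outcome S A)} {x : ℝ} (hx : 0 ≤ x)
    (hdone : ∀ f ∈ B, M.IsOptimalUpTo (3 * (H * ε)) (gr f) → Outcome.done (gr f) (m + p.nAct) ∈ E)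
    (hnext : ∀ f ∈ B, ∀ t, ε < M.meanResidual gr (gr f) f t → ∀ D' : Data S A H p.nElim,
      M.ElimAccurate gr t (gr f) F p.zetaElim D' → ENNReal.ofReal (1 - x) ≤
        M.oliveLaw gr p ch N (k + 1) {g ∈ B | |M.elimEstimate gr g t D'| ≤ p.zetaElim}
          (m + p.nAct + p.nElim) E) :
    ENNReal.ofReal (1 - (x + yElim + yAct)) ≤ M.oliveLaw gr p ch (N + 1) k B m E := by
  have hne : B.Nonempty := ⟨_, hqStar⟩
  rw [oliveLaw_succ_apply hfin hF hch hB hne]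
  have hf := hch.optimist_mem k B hB hne
  have hopt := hch.optimist_max k B hB hne _ hqStar
  have hpick := hch.pick_spec k B hB hne
  set f := ch.optimist k B
  rw [hzeta] at hpick ⊢
  refine ofReal_one_sub_add_le_lintegral (by positivity) hyAct (hact f (hB hf)) fun D hD => ?_
  have hacc : M.ActAccurate gr f ε D := not_not.1 hD
  split_ifs with hterm
  · rw [Measure.dirac_apply_of_mem
      (hdone f hf (isOptimalUpTo_of_actAccurate hF (hB hf) hopt hacc hterm))]
    exact ENNReal.ofReal_le_one.2 (by linarith)
  · have hactive : ∃ t, 2 * ε < M.actEstimate f t D := by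
      by_contra! hle
      refine hterm ((Finset.sum_le_card_nsmul _ _ _ fun h _ => hle h).trans_eq ?_)
      rw [Finset.card_fin, nsmul_eq_mul]
    have hlarge : ε < M.meanResidual gr (gr f) f (ch.pick k B D) := by
      linarith [(abs_le.1 (hacc (ch.pick k B D))).2, hpick D hactive]
    exact ofReal_one_sub_add_le_lintegral hx hyElim (helim f (hB hf) _) fun D' hD' =>
      hnext f hf _ hlarge D' (not_not.1 hD')

variable (hd : M.vbeDim gr F ε ≤ d) (hzetaElim : Real.sqrt d * (2 * p.zetaElim) ≤ ε)
include hd hzetaElim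

theorem le_oliveLaw_of_isVersionSpace {N k m total : ℕ} {n : Fin H → ℕ}
    (hB : M.IsVersionSpace gr F ε (2 * p.zetaElim) B n) (hN : H * d < N + ∑ h, n h)
    (htotal : m + N * (p.nAct + p.nElim) ≤ total) :
    ENNReal.ofReal (1 - N * (yAct + yElim)) ≤ M.oliveLaw gr p ch N k B m
      {o | ∃ π n, o = Outcome.done π n ∧ M.IsOptimalUpTo (3 * (H * ε)) π ∧ n ≤ total} := by
  induction N generalizing k B m n with
  | zero => exact absurd (hB.sum_le hd) (by omega)
  | succ N ih =>
    rw [Nat.succ_mul] at htotal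
    rw [show 1 - ((N + 1 : ℕ) : ℝ) * (yAct + yElim) = 1 - (N * (yAct + yElim) + yElim + yAct) by
      push_cast; ring]
    refine le_oliveLaw_succ hfin hF hch hyAct hyElim hzeta hact helim hB.subset hB.qStarFun_mem
      (by positivity) (fun f _ hopt => ⟨_, _, rfl, hopt, by omega⟩)
      fun f hf t hlarge D' hacc => ih (hB.eliminate hF hd hzetaElim hf hlarge hacc) ?_ (by omega)
    rw [Finset.sum_update_of_mem (Finset.mem_univ t), Finset.sdiff_singleton_eq_erase]
    have := Finset.add_sum_erase Finset.univ n (Finset.mem_univ t)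
    omega

theorem le_oliveProb :
    ENNReal.ofReal (1 - (H * d + 1 : ℕ) * (yAct + yElim)) ≤ M.oliveProb gr F p ch
      fun π n => M.IsOptimalUpTo (3 * (H * ε)) π ∧ n ≤ (H * d + 1) * (p.nAct + p.nElim) := by
  refine le_iSup_of_le (H * d + 1) ?_
  refine le_oliveLaw_of_isVersionSpace (n := 0) hfin hF hch hyAct hyElim hzeta hact helim hd
    hzetaElim ⟨subset_rfl, hF.qStarFun_mem, fun _ => hasHistory_zero⟩ (by omega) (by omega)

end Confidence

end Run

end MDP

/-! ### Sample sizes -/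

section Parameters

lemma half_le_log {x : ℝ} (hx : 2 ≤ x) : 1 / 2 ≤ Real.log x := by
  linarith [Real.log_two_gt_d9, Real.log_le_log two_pos hx]

lemma mul_two_mul_exp_neg_le {N X x b δ : ℝ} (hN : 0 < N) (hX : 2 ≤ X) (hb : 0 < b)
    (hbX : b ≤ δ * X) (hx : Real.log N + 4 * Real.log X ≤ x) :
    N * (2 * Real.exp (-x)) ≤ δ / (4 * b) := by
  have hX0 : 0 < X := by linarith
  have hX3 : 2 ^ 3 ≤ X ^ 3 := pow_le_pow_left₀ zero_le_two hX 3
  have hexp : Real.exp (Real.log N + 4 * Real.log X) = N * X ^ 4 := by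
    rw [Real.exp_add, Real.exp_log hN, ← Real.rpow_natCast, Real.rpow_def_of_pos hX0,
      mul_comm 4]
    norm_num
  calc N * (2 * Real.exp (-x)) ≤ N * (2 * Real.exp (-(Real.log N + 4 * Real.log X))) := by gcongr
    _ = 2 / X ^ 4 := by
        rw [Real.exp_neg, hexp]
        field_simp
    _ ≤ δ / (4 * b) := by
        rw [div_le_div_iff₀ (by positivity) (by positivity)]
        calc 2 * (4 * b) = 2 ^ 3 * b := by ring
          _ ≤ X ^ 3 * (δ * X) := by gcongr
          _ = δ * X ^ 4 := by ring

variable {H d nA nF : ℕ} {δ ε : ℝ}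

lemma sqrt_mul_two_mul_zetaElim (hd : 0 < d) (c : ℝ) :
    Real.sqrt d * (2 * (oliveParams c H d nA nF δ ε).zetaElim) = ε / H := by
  have hsqrt : Real.sqrt d ≠ 0 := Real.sqrt_ne_zero'.2 (Nat.cast_pos.2 hd)
  unfold oliveParams
  field_simp

lemma zetaElim_nonneg (hε : 0 ≤ ε) (c : ℝ) : 0 ≤ (oliveParams c H d nA nF δ ε).zetaElim :=
  div_nonneg hε (by positivity)

lemma zetaElim_le_one (hε : ε ≤ 1) (hH : 0 < H) (hd : 0 < d) (c : ℝ) :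
    (oliveParams c H d nA nF δ ε).zetaElim ≤ 1 := by
  have hH1 : (1 : ℝ) ≤ H := Nat.one_le_cast.2 hH
  have hsqrt : 1 ≤ Real.sqrt d := Real.one_le_sqrt.2 (Nat.one_le_cast.2 hd)
  refine div_le_one_of_le₀ (hε.trans ?_) (by positivity)
  nlinarith

section Confidence

variable (hε : 0 < ε) (hδ : 0 < δ) (hratio : 2 * (δ * ε) ≤ (H : ℝ) * d * nA)
include hε hδ hratio

lemma pos_of_two_mul_le : 0 < H ∧ 0 < d ∧ 0 < nA := by
  have hpos : (0 : ℝ) < (H * d * nA : ℕ) := by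
    push_cast
    exact lt_of_lt_of_le (by positivity) hratio
  simpa only [CanonicallyOrderedAdd.mul_pos, and_assoc] using Nat.cast_pos.1 hpos

lemma two_le_ratio : 2 ≤ (H : ℝ) * d * nA / (δ * ε) :=
  (le_div_iff₀ (by positivity)).2 hratio

lemma horizon_mul_dim_le (hε1 : ε ≤ 1) : (H : ℝ) * d ≤ δ * (H * d * nA / (δ * ε)) := by
  obtain ⟨-, -, hA⟩ := pos_of_two_mul_le hε hδ hratio
  have hA1 : (1 : ℝ) ≤ nA := Nat.one_le_cast.2 hA
  rw [mul_div_assoc', le_div_iff₀ (by positivity)]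
  calc H * d * (δ * ε) ≤ H * d * (δ * nA) := by gcongr; linarith
    _ = δ * (H * d * nA) := by ring

lemma act_failure_le (hε1 : ε ≤ 1) (hδ1 : δ ≤ 1) :
    H * (2 * Real.exp (-((oliveParams 640 H d nA nF δ ε).nAct * (ε / H) ^ 2 / 16))) ≤
      δ / (4 * (H * d)) := by
  obtain ⟨hH, hd, -⟩ := pos_of_two_mul_le hε hδ hratio
  have hX := two_le_ratio hε hδ hratio
  have hHd := horizon_mul_dim_le hε hδ hratio hε1
  set X := (H : ℝ) * d * nA / (δ * ε) with hXdef
  have hH0 : (0 : ℝ) < H := Nat.cast_pos.2 hH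
  have hHX : (H : ℝ) ≤ X := by
    calc (H : ℝ) ≤ H * d := le_mul_of_one_le_right hH0.le (Nat.one_le_cast.2 hd)
      _ ≤ δ * X := hHd
      _ ≤ X := mul_le_of_le_one_left (by linarith) hδ1
  refine mul_two_mul_exp_neg_le hH0 hX (by positivity) hHd ?_
  have hlog : 0 ≤ Real.log X := Real.log_nonneg (by linarith)
  calc Real.log H + 4 * Real.log X ≤ 640 * Real.log X / 16 := by
        linarith [Real.log_le_log hH0 hHX]
    _ = ((H : ℝ) ^ 2 * iota 640 H d nA δ ε / ε ^ 2) * (ε / H) ^ 2 / 16 := by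
        rw [iota, ← hXdef]
        field_simp
    _ ≤ (oliveParams 640 H d nA nF δ ε).nAct * (ε / H) ^ 2 / 16 := by
        gcongr
        exact Nat.le_ceil _

lemma elim_failure_le (hε1 : ε ≤ 1) (hF : 2 ≤ nF) :
    nF * (2 * Real.exp (-((oliveParams 640 H d nA nF δ ε).nElim *
      (oliveParams 640 H d nA nF δ ε).zetaElim ^ 2 / (16 * nA)))) ≤ δ / (4 * (H * d)) := by
  obtain ⟨hH, hd, hA⟩ := pos_of_two_mul_le hε hδ hratio
  have hX := two_le_ratio hε hδ hratio
  have hF2 : (2 : ℝ) ≤ nF := Nat.ofNat_le_cast.2 hF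
  refine mul_two_mul_exp_neg_le (by linarith) hX (by positivity)
    (horizon_mul_dim_le hε hδ hratio hε1) ?_
  set X := (H : ℝ) * d * nA / (δ * ε) with hXdef
  have hlogX := half_le_log hX
  have hlogF := half_le_log hF2
  calc Real.log nF + 4 * Real.log X ≤ Real.log nF * (640 * Real.log X) / 64 := by nlinarith
    _ = ((H : ℝ) ^ 2 * d * nA * Real.log nF * iota 640 H d nA δ ε / ε ^ 2) *
          (ε / (2 * H * Real.sqrt d)) ^ 2 / (16 * nA) := by
        rw [iota, ← hXdef, div_pow, mul_pow, Real.sq_sqrt (Nat.cast_nonneg d)]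
        field_simp
        norm_num
    _ ≤ (oliveParams 640 H d nA nF δ ε).nElim *
          (oliveParams 640 H d nA nF δ ε).zetaElim ^ 2 / (16 * nA) := by
        unfold oliveParams
        gcongr
        exact Nat.le_ceil _

lemma failure_le (hε1 : ε ≤ 1) (hδ1 : δ ≤ 1) (hF : 2 ≤ nF) :
    ((H * d + 1 : ℕ) : ℝ) *
      (H * (2 * Real.exp (-((oliveParams 640 H d nA nF δ ε).nAct * (ε / H) ^ 2 / 16))) +
        nF * (2 * Real.exp (-((oliveParams 640 H d nA nF δ ε).nElim *
          (oliveParams 640 H d nA nF δ ε).zetaElim ^ 2 / (16 * nA))))) ≤ δ := by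
  obtain ⟨hH, hd, -⟩ := pos_of_two_mul_le hε hδ hratio
  have hphases : H * d + 1 ≤ 2 * (H * d) := by linarith [Nat.mul_pos hH hd]
  calc _ ≤ ((2 * (H * d) : ℕ) : ℝ) * (δ / (4 * (H * d)) + δ / (4 * (H * d))) := by
        gcongr
        · exact act_failure_le hε hδ hratio hε1 hδ1
        · exact elim_failure_le hε hδ hratio hε1 hF
    _ = δ := by
        push_cast
        field_simp
        norm_num

lemma two_le_iota : 2 ≤ iota 640 H d nA δ ε := by
  rw [iota]
  linarith [half_le_log (two_le_ratio hε hδ hratio)]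

lemma nAct_add_nElim_le (hε1 : ε ≤ 1) (hF : 2 ≤ nF) :
    ((oliveParams 640 H d nA nF δ ε).nAct + (oliveParams 640 H d nA nF δ ε).nElim : ℝ) ≤
      8 * ((H : ℝ) ^ 2 * d * nA * Real.log nF * iota 640 H d nA δ ε / ε ^ 2) := by
  obtain ⟨hH, hd, hA⟩ := pos_of_two_mul_le hε hδ hratio
  have hlogF : 1 / 2 ≤ Real.log nF := half_le_log (Nat.ofNat_le_cast.2 hF)
  have hiota := two_le_iota hε hδ hratio
  set y := (H : ℝ) ^ 2 * iota 640 H d nA δ ε / ε ^ 2 with hy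
  set w := (H : ℝ) ^ 2 * d * nA * Real.log nF * iota 640 H d nA δ ε / ε ^ 2 with hw
  have hy2 : 2 ≤ y := by
    rw [hy, le_div_iff₀ (by positivity)]
    calc 2 * ε ^ 2 ≤ 2 * 1 := by gcongr; exact pow_le_one₀ hε.le hε1
      _ ≤ iota 640 H d nA δ ε * H ^ 2 := by
        gcongr
        exact one_le_pow₀ (Nat.one_le_cast.2 hH)
      _ = H ^ 2 * iota 640 H d nA δ ε := mul_comm _ _
  have hyw : y ≤ 2 * w := by
    have hdA : (1 : ℝ) ≤ d * nA :=
      one_le_mul_of_one_le_of_one_le (Nat.one_le_cast.2 hd) (Nat.one_le_cast.2 hA)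
    calc y ≤ y * (2 * (d * nA * Real.log nF)) :=
          le_mul_of_one_le_right (by linarith) (by nlinarith)
      _ = 2 * w := by
        rw [hy, hw]
        ring
  have hact : ((oliveParams 640 H d nA nF δ ε).nAct : ℝ) < y + 1 :=
    Nat.ceil_lt_add_one (by linarith)
  have helim : ((oliveParams 640 H d nA nF δ ε).nElim : ℝ) < w + 1 :=
    Nat.ceil_lt_add_one (by linarith)
  linarith

lemma episodes_le (hε1 : ε ≤ 1) (hF : 2 ≤ nF) :
    (((H * d + 1) * ((oliveParams 640 H d nA nF δ ε).nAct +
      (oliveParams 640 H d nA nF δ ε).nElim) : ℕ) : ℝ) ≤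
      16 * ((H : ℝ) ^ 3 * d ^ 2 * nA * Real.log nF * iota 640 H d nA δ ε / ε ^ 2) := by
  obtain ⟨hH, hd, -⟩ := pos_of_two_mul_le hε hδ hratio
  have hphases : H * d + 1 ≤ 2 * (H * d) := by linarith [Nat.mul_pos hH hd]
  rw [Nat.cast_mul, Nat.cast_add (oliveParams 640 H d nA nF δ ε).nAct]
  calc _ ≤ ((2 * (H * d) : ℕ) : ℝ) *
        (8 * ((H : ℝ) ^ 2 * d * nA * Real.log nF * iota 640 H d nA δ ε / ε ^ 2)) := by
        gcongr
        exact nAct_add_nElim_le hε hδ hratio hε1 hF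
    _ = _ := by
        push_cast
        ring

end Confidence

end Parameters

end VOlive

theorem mainTheorem8_general {S : Type u} {A : Type v} [MeasurableSpace S] [MeasurableSpace A]
    [MeasurableSingletonClass A] [Fintype A] [Nonempty A] {H : ℕ} {M : MDP S A H}
    {F : Set (QFun S A H)} {gr : QFun S A H → Policy S A} {d : ℕ} {ε δ : ℝ}
    (hcard : 2 ≤ F.ncard) (hF : M.IsRealizableClass gr F) (hε : 0 < ε) (hε1 : ε ≤ 1) (hδ : 0 < δ)
    (hδ1 : δ ≤ 1) (hratio : 2 * (δ * ε) ≤ (H : ℝ) * d * Fintype.card A)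
    (hdim : M.vbeDim gr F (ε / H) ≤ d)
    {ch : Choices S A H (oliveParams 640 H d (Fintype.card A) F.ncard δ ε).nAct}
    (hch : ch.Valid M gr F (oliveParams 640 H d (Fintype.card A) F.ncard δ ε)) :
    ENNReal.ofReal (1 - δ) ≤
      M.oliveProb gr F (oliveParams 640 H d (Fintype.card A) F.ncard δ ε) ch fun π n =>
        M.IsOptimalUpTo (3 * ε) π ∧ (n : ℝ) ≤ 16 * ((H : ℝ) ^ 3 * d ^ 2 * Fintype.card A *
          Real.log F.ncard * iota 640 H d (Fintype.card A) δ ε / ε ^ 2) := by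
  obtain ⟨hH, hd, -⟩ := pos_of_two_mul_le hε hδ hratio
  have hfin : F.Finite := Set.finite_of_ncard_pos (by omega)
  have hεH : ε / H ≤ 1 := (div_le_self hε.le (Nat.one_le_cast.2 hH)).trans hε1
  have hprob := MDP.le_oliveProb hfin hF hch (by positivity) (by positivity)
    (mul_div_assoc 2 ε (H : ℝ))
    (fun f hf => M.dataLaw_not_actAccurate_le gr (hF.regular f hf) _ (by positivity) hεH)
    (fun f _ t => M.dataLaw_not_elimAccurate_le gr t (gr f) hfin hF.regular _
      (zetaElim_nonneg hε.le 640) (zetaElim_le_one hε1 hH hd 640))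
    hdim (sqrt_mul_two_mul_zetaElim hd 640).le
  refine (ENNReal.ofReal_le_ofReal ?_).trans (hprob.trans (M.oliveProb_mono fun π n => ?_))
  · linarith [failure_le hε hδ hratio hε1 hδ1 hcard]
  · rw [mul_div_cancel₀ ε (Nat.cast_ne_zero.2 hH.ne')]
    exact And.imp_right fun hn =>
      (Nat.cast_le.2 hn).trans (episodes_le hε hδ hratio hε1 hcard)

theorem mainTheorem8 :
    ∃ c C₁ C₂ : ℝ, 0 < c ∧ 0 < C₁ ∧ 0 < C₂ ∧
      ∀ (S : Type u) (A : Type v) [MeasurableSpace S] [MeasurableSpace A]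
        [MeasurableSingletonClass A] [Fintype A] [Nonempty A]
        (H : ℕ) (M : MDP S A H)
        (F : Fin H → Set (S → A → ℝ)) (gr : QFun S A H → Policy S A)
        (d : ℕ) (ε δ : ℝ),
        -- the class is finite, with at least two elements, and consists of measurable functions
        -- with values in `[0, 1]`
        (productClass F).Finite → 2 ≤ (productClass F).ncard →
        (∀ h, ∀ f ∈ F h, Measurable (fun q : S × A => f q.1 q.2) ∧
          ∀ s a, f s a ∈ Set.Icc (0 : ℝ) 1) →
        -- `gr f` is a greedy policy of `f`
        (∀ f ∈ productClass F, IsGreedy f (gr f)) →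
        -- realizability
        (∀ h : Fin H, M.qStar h ∈ F h) →
        0 < ε → ε ≤ 1 → 0 < δ → δ ≤ 1 → 1 ≤ H → 1 ≤ d →
        2 * (δ * ε) ≤ (H : ℝ) * d * Fintype.card A →
        M.vbeDim gr (productClass F) (ε / H) ≤ (d : ℕ∞) →
        ∀ ch : Choices S A H
            (oliveParams c H d (Fintype.card A) (productClass F).ncard δ ε).nAct,
          Choices.Valid M gr (productClass F)
            (oliveParams c H d (Fintype.card A) (productClass F).ncard δ ε) ch →
          ENNReal.ofReal (1 - δ) ≤
            M.oliveProb gr (productClass F)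
              (oliveParams c H d (Fintype.card A) (productClass F).ncard δ ε) ch
              (fun π n => M.IsOptimalUpTo (C₁ * ε) π ∧
                (n : ℝ) ≤ C₂ * ((H : ℝ) ^ 3 * d ^ 2 * Fintype.card A *
                  Real.log (productClass F).ncard *
                    iota c H d (Fintype.card A) δ ε / ε ^ 2)) :=
  ⟨640, 3, 16, by norm_num, by norm_num, by norm_num,
    fun _ _ _ _ _ _ _ _ _ _ _ _ _ _ _ hcard hreg hgr hreal hε hε1 hδ hδ1 _ _ hratio hdim _ hch =>
      mainTheorem8_general hcard
        ⟨fun f hf h => hreg h (f h) (hf h (Set.mem_univ h)), hgr, fun h _ => hreal h⟩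
        hε hε1 hδ hδ1 hratio hdim hch⟩
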